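/- **Conventions.** Let $\mathcal T$ be a triangulated category with small coproducts and $\mathcal T^c$ its compact objects. For a skeletally small subcategory $\mathcal S\subseteq\mathcal T$ let $\langle\mathcal S\rangle$ be the smallest thick subcategory containing $\mathcal S$, $\overline{\langle\mathcal S\rangle}$ the smallest localizing subcategory (strictly full, triangulated, closed under small coproducts) containing $\mathcal S$, $\langle\mathcal S\rangle^{(-\infty,0]}$ the smallest suspended subcategory (strictly full, containing $0$, closed under $[1]$, extensions and direct summands) containing $\mathcal S$, and $\overline{\langle\mathcal S\rangle}^{(-\infty,0]}$ the smallest cocomplete preaisle (strictly full, closed under $[1]$, extensions and small coproducts) containing $\mathcal S$. Then $\mathcal S$ is *proxy small* if $\overline{\langle \mathcal S\rangle}=\overline{\langle\langle \mathcal S\rangle\cap\mathcal T^c\rangle}$, and *$t$-proxy small* if $\overline{\langle \mathcal S\rangle}^{(-\infty,0]}=\overline{\langle\langle \mathcal S\rangle^{(-\infty,0]}\cap\mathcal T^c\rangle}^{(-\infty,0]}$; an object is (t-)proxy small if it is so as a singleton. For a Noetherian commutative ring $S$, $D(S)$ is the derived category of $S$-modules (equivalently $D_{\mathrm{qc}}(\operatorname{Spec}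 S)$), and $D^b_{\mathrm{coh}}(S)\subseteq D(S)$ is the subcategory of complexes with bounded, finitely generated cohomology. For $E\in D^b_{\mathrm{coh}}(S)$, (t-)proxy smallness is taken in $D(S)$. **Statement.** 1. Let $R$ be a commutative Noetherian ring, $X$ an $R$-module and $Y$ a finitely generated $R$-module with $\operatorname{Ext}^i_R(X,R)=0$ for all $i>0$, $\operatorname{Ext}^1_R(X,Y)\neq0$ and $\operatorname{Ext}^i_R(X,Y)=0$ for all $i>1$. Let $R\ltimes Y$ be the trivial extension, and regard $R$ as an $R\ltimes Y$-module through the projection $R\ltimes Y\to R$. Then $R\ltimes Y$ is Noetherian and the object $(R\ltimes Y)[1]\oplus R$ of $D^b_{\mathrm{coh}}(R\ltimes Y)$ is proxy small but not $t$-proxy small. 2. Such data exist over a local Artinian Gorenstein ring. Let $k$ be a field, let $\alpha\in k^\times$ have infinite multiplicative order, and let $A=k[x_1,\dots,x_5]/I$, where $I$ is generated by $$\alpha x_1x_3+x_2x_3,\quad x_1x_4+x_2x_4,\quad x_3^2+\alpha x_1x_5-x_2x_5,\quad x_4^2+x_1x_5-x_2x_5,\quad x_1^2,\ x_2^2,\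 x_3x_4,\ x_3x_5,\ x_4x_5,\ x_5^2 .$$ Then $A$ is a local Artinian Gorenstein ring, and with $$M=\operatorname{coker}\left(A^2\xrightarrow{\begin{pmatrix}x_1&\alpha x_3\\ x_4&x_2\end{pmatrix}}A^2\right),\qquad T_1=A/(x_1-x_3,\;x_1-x_4,\;x_2-\alpha x_1,\;x_5),$$ one has $\operatorname{Ext}^i_A(M,A)=0$ for all $i>0$, $\operatorname{Ext}^1_A(M,T_1)\ne0$ and $\operatorname{Ext}^i_A(M,T_1)=0$ for all $i>1$. Consequently $(A\ltimes T_1)[1]\oplus A\in D^b_{\mathrm{coh}}(A\ltimes T_1)$ is proxy small but not $t$-proxy small. 3. Hence $t$-proxy smallness is strictly stronger than proxy smallness: in every triangulated category with small coproducts each $t$-proxy small (skeletally small) subcategory is proxy small, while there are a local Artinian commutative ring $S$ and an object of $D^b_{\mathrm{coh}}(S)$ that is proxy small but not $t$-proxy small. -/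

import Mathlib

open CategoryTheory CategoryTheory.Limits

universe w v u u₁ v₁

namespace ProxySmall

section Triangulated

variable {C : Type u} [Category.{v} C] [HasZeroObject C] [HasShift C ℤ] [Preadditive C]
  [∀ n : ℤ, (shiftFunctor C n).Additive] [Pretriangulated C]

/-- An object `X` is compact if for every family `(Y j)` indexed by a `w`-small set that has a
coproduct, the canonical map `⨁ j, Hom(X, Y j) → Hom(X, ∐ Y)` is bijective. -/
def IsCompact (X : C) : Prop :=
  ∀ (J : Type w) [DecidableEq J] (Y : J → C) (c : Cofan Y), Nonempty (IsColimit c) →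
    Function.Bijective
      (DirectSum.toAddMonoid (fun j => Preadditive.rightComp X (c.inj j)) :
        (DirectSum J fun j => (X ⟶ Y j)) →+ (X ⟶ c.pt))

/-- The subcategory of compact objects. -/
def compacts : ObjectProperty C := fun X => IsCompact.{w} X

/-- Closure under all `w`-small coproducts that exist in the ambient category. -/
def IsClosedUnderCoproducts (P : ObjectProperty C) : Prop :=
  ∀ J : Type w, P.IsClosedUnderColimitsOfShape (Discrete J)

/-- A thick subcategory: a strictly full triangulated subcategory closed under direct summands. -/
structure IsThick (P : ObjectProperty C) : Prop where
  triangulated : P.IsTriangulated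
  retracts : P.IsStableUnderRetracts

/-- A localizing subcategory: a strictly full triangulated subcategory closed under small
coproducts. -/
structure IsLocalizing (P : ObjectProperty C) : Prop where
  isoClosed : P.IsClosedUnderIsomorphisms
  triangulated : P.IsTriangulated
  coproducts : IsClosedUnderCoproducts.{w} P

/-- A preaisle: a strictly full subcategory (containing the zero objects) closed under
the shift `[1]` and under extensions. -/
structure IsPreaisle (P : ObjectProperty C) : Prop where
  isoClosed : P.IsClosedUnderIsomorphisms
  zero : P.ContainsZero
  shift : P.IsStableUnderShiftBy (1 : ℤ)
  extensions : P.IsTriangulatedClosed₂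

/-- A suspended subcategory: a preaisle closed under direct summands. -/
structure IsSuspended (P : ObjectProperty C) : Prop extends IsPreaisle P where
  retracts : P.IsStableUnderRetracts

/-- A cocomplete preaisle: a preaisle closed under small coproducts. -/
structure IsCocompletePreaisle (P : ObjectProperty C) : Prop extends IsPreaisle P where
  coproducts : IsClosedUnderCoproducts.{w} P

/-- `⟨P⟩`: the smallest thick subcategory containing `P`. -/
def thick (P : ObjectProperty C) : ObjectProperty C :=
  fun X => ∀ Q : ObjectProperty C, IsThick Q → P ≤ Q → Q X

/-- The smallest localizing subcategory containing `P`. -/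
def localizing (P : ObjectProperty C) : ObjectProperty C :=
  fun X => ∀ Q : ObjectProperty C, IsLocalizing.{w} Q → P ≤ Q → Q X

/-- `⟨P⟩^{(-∞,0]}`: the smallest suspended subcategory containing `P`. -/
def suspended (P : ObjectProperty C) : ObjectProperty C :=
  fun X => ∀ Q : ObjectProperty C, IsSuspended Q → P ≤ Q → Q X

/-- The smallest cocomplete preaisle containing `P`. -/
def cocompletePreaisle (P : ObjectProperty C) : ObjectProperty C :=
  fun X => ∀ Q : ObjectProperty C, IsCocompletePreaisle.{w} Q → P ≤ Q → Q X

/-- `P` is proxy small: the thick subcategory it generates contains enough compact objects to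
generate the localizing subcategory generated by `P`. -/
def IsProxySmall (P : ObjectProperty C) : Prop :=
  localizing.{w} P = localizing.{w} (thick P ⊓ compacts.{w})

/-- `P` is `t`-proxy small: the suspended subcategory it generates contains enough compact objects
to generate the cocomplete preaisle generated by `P`. -/
def IsTProxySmall (P : ObjectProperty C) : Prop :=
  cocompletePreaisle.{w} P = cocompletePreaisle.{w} (suspended P ⊓ compacts.{w})

/-- An object is proxy small if it is so as a singleton subcategory. -/
def IsProxySmallObj (X : C) : Prop := IsProxySmall.{w} (ObjectProperty.singleton X)

/-- An object is `t`-proxy small if it is so as a singleton subcategory. -/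
def IsTProxySmallObj (X : C) : Prop := IsTProxySmall.{w} (ObjectProperty.singleton X)

end Triangulated

section Rings

/-- The derived category of modules over a ring is taken to be the standard localization of the
category of cochain complexes at the quasi-isomorphisms. -/
noncomputable instance hasDerivedCategoryModuleCat (S : Type u) [CommRing S] :
    HasDerivedCategory.{u + 1} (ModuleCat.{u} S) :=
  HasDerivedCategory.standard _

/-- The (unbounded) derived category `D(S)` of all `S`-modules. -/
noncomputable abbrev D (S : Type u) [CommRing S] : Type (u + 1) :=
  DerivedCategory (ModuleCat.{u} S)

/-- An `S`-module, as a complex concentrated in degree `0`. -/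
noncomputable abbrev inDegreeZero (S : Type u) [CommRing S] (M : ModuleCat.{u} S) : D S :=
  (DerivedCategory.singleFunctor (ModuleCat.{u} S) 0).obj M

/-- Membership in `D^b_coh(S)` for a Noetherian ring `S`: all cohomology modules are finitely
generated and only finitely many of them are nonzero. -/
def IsBoundedCoherent {S : Type u} [CommRing S] (E : D S) : Prop :=
  (∀ n : ℤ, Module.Finite S ((DerivedCategory.homologyFunctor (ModuleCat.{u} S) n).obj E)) ∧
  ∃ N : ℕ, ∀ n : ℤ, (N : ℤ) < |n| →
    IsZero ((DerivedCategory.homologyFunctor (ModuleCat.{u} S) n).obj E)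

/-- A Gorenstein local ring: a Noetherian local ring of finite injective dimension over itself. -/
structure IsGorensteinLocalRing (R : Type u) [CommRing R] : Prop where
  noetherian : IsNoetherianRing R
  isLocal : IsLocalRing R
  injdim : ∃ n : ℕ, HasInjectiveDimensionLE (ModuleCat.of R R) n

variable (R : Type u) [CommRing R] (Y : Type u) [AddCommGroup Y] [Module R Y] [Module Rᵐᵒᵖ Y]
  [IsCentralScalar R Y]

/-- `R` as a module over the trivial extension `R ⋉ Y`, through the projection `R ⋉ Y → R`. -/
noncomputable abbrev baseModule : ModuleCat.{u} (TrivSqZeroExt R Y) :=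
  (ModuleCat.restrictScalars (TrivSqZeroExt.fstHom R R Y).toRingHom).obj (ModuleCat.of R R)

/-- The object `(R ⋉ Y)[1] ⊕ R` of `D(R ⋉ Y)`. -/
noncomputable def trivExtObj : D (TrivSqZeroExt R Y) :=
  (inDegreeZero (TrivSqZeroExt R Y)
    (ModuleCat.of (TrivSqZeroExt R Y) (TrivSqZeroExt R Y)))⟦(1 : ℤ)⟧ ⊞
  inDegreeZero (TrivSqZeroExt R Y) (baseModule R Y)

end Rings

section JorgensenSega

open MvPolynomial

variable (k : Type u) [Field k] (α : k)

/-- The ten quadrics in `k[x₁, …, x₅]` (indexed here by `0, …, 4`) that define the ring. -/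
noncomputable def ringIdeal : Ideal (MvPolynomial (Fin 5) k) :=
  Ideal.span
    {C α * X 0 * X 2 + X 1 * X 2,
     X 0 * X 3 + X 1 * X 3,
     X 2 ^ 2 + C α * X 0 * X 4 - X 1 * X 4,
     X 3 ^ 2 + X 0 * X 4 - X 1 * X 4,
     X 0 ^ 2,
     X 1 ^ 2,
     X 2 * X 3,
     X 2 * X 4,
     X 3 * X 4,
     X 4 ^ 2}

/-- The Artinian Gorenstein ring `A = k[x₁, …, x₅] / I`. -/
abbrev A : Type u := MvPolynomial (Fin 5) k ⧸ ringIdeal k α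

/-- The class of the `i`-th variable in `A`. -/
noncomputable def x (i : Fin 5) : A k α := Ideal.Quotient.mk (ringIdeal k α) (X i)

/-- The scalar `α`, as an element of `A`. -/
noncomputable def scalar : A k α := Ideal.Quotient.mk (ringIdeal k α) (C α)

/-- The matrix `(x₁, α x₃; x₄, x₂)`. -/
noncomputable def matrixM : Matrix (Fin 2) (Fin 2) (A k α) :=
  !![x k α 0, scalar k α * x k α 2; x k α 3, x k α 1]

/-- The module `M`: the cokernel of the map `A² → A²` given by the above matrix. -/
abbrev M : Type u := (Fin 2 → A k α) ⧸ LinearMap.range (matrixM k α).mulVecLin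

/-- The module `T₁ = A / (x₁ - x₃, x₁ - x₄, x₂ - α x₁, x₅)`, of length two. -/
abbrev T : Type u :=
  A k α ⧸ Ideal.span
    {x k α 0 - x k α 2, x k α 0 - x k α 3, x k α 1 - scalar k α * x k α 0, x k α 4}

end JorgensenSega

end ProxySmall

set_option linter.unusedSectionVars false

/-! Write `S = R ⋉ Y` and `E = S[1] ⊕ R`. A thick subcategory may undo the shift, so `⟨E⟩` contains
the compact object `S`; free resolutions put `R` into the localizing subcategory generated by `S`,
and `E` is proxy small. A suspended subcategory cannot undo the shift, and its compact objects turn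
out to be blind to the summand `R`.

The obstruction is `Ext` over `R` from `X`. In positive degrees only `Ext¹(X, S) = Ext¹(X, Y)` is
nonzero, and the shift moves it to degree `0`. So `Ext^{>0}(X, -)` vanishes on `S[1]` and on `R`,
hence on the suspended subcategory generated by `E`. Let `𝔞 ⊆ S` be the annihilator of `Ext¹(X, S)`
and `V = S/𝔞`. The key claim (`eq_zero_of_isCompact`) is that a compact connective `Z` with finite
cohomology and `Ext¹(X, Z) = 0` has no nonzero map to `V`. Resolve `Z` by finite free modules: `Z₀ =
Z` and `Zₙ₊₁` is the cone of `Fₙ → Zₙ`, where `Fₙ` is a power of `S[n]`. Given `f : Z → V`, lift `F₀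
→ Z → V` to `g : F₀ → S`. A class of `Ext¹(X, F₀)` dies in `Ext¹(X, Z)`, so it comes from a map `X →
Z₁`. By compactness `Z → Zₙ` vanishes for some large `n`; with `Ext^{≥2}(X, S) = 0` this lets one
lift coordinate classes further to `F₁`. There `g` acts through `F₁ → F₀[1] → S[1]`, whose entries
lie in `𝔞`, so the result is zero. Thus `g` has entries in `𝔞`, `F₀ → V` vanishes, and `f` factors
through `Z₁`, which is too connective to map to `V`.

The objects without maps to `V[-i]`, `i ≥ 0`, form a cocomplete preaisle (`leftOrth`). If `E` were
`t`-proxy small it would lie there; but `R → V`, `1 ↦ 1`, is well defined because `Ext¹(X, R) = 0`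
forces `Y ⊆ 𝔞`, and nonzero because `Ext¹(X, Y) ≠ 0` forces `1 ∉ 𝔞`.

For the example, explicit coordinates show that `A` is self-injective and that the matrices `dₙ =
(x₁, αⁿx₃; x₄, x₂)` form a free resolution of `M = coker d₁`. Since `T ≅ k[ε]`, mapping into `T`
turns `dₙ` into `ε` times the scalar matrix `(1, αⁿ; 1, α)`, which for `n ≥ 1` is singular only at
`n = 1`. Hence `Ext¹(M, T)` is the only nonzero positive `Ext`. -/

namespace ProxySmall

/-! ### Localizing subcategories, the Eilenberg swindle and telescopes -/

section Triangulated

open Pretriangulated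

variable {C : Type u} [Category.{v} C] [HasZeroObject C] [HasShift C ℤ] [Preadditive C]
  [∀ n : ℤ, (shiftFunctor C n).Additive] [Pretriangulated C]

lemma IsClosedUnderCoproducts.nat {Q : ObjectProperty C} (hQ : IsClosedUnderCoproducts.{w} Q) :
    Q.IsClosedUnderColimitsOfShape (Discrete ℕ) := by
  have := hQ (ULift.{w} ℕ)
  exact ObjectProperty.IsClosedUnderColimitsOfShape.of_equivalence
    (P := Q) (J := Discrete (ULift.{w} ℕ)) (Discrete.equivalence Equiv.ulift)

lemma hasCoproducts_nat [HasCoproducts.{w} C] : HasCoproductsOfShape ℕ C :=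
  hasColimitsOfShape_of_equivalence (Discrete.equivalence (Equiv.ulift.{w} : ULift ℕ ≃ ℕ))

lemma IsClosedUnderCoproducts.sigma {Q : ObjectProperty C} {J : Type*}
    [Q.IsClosedUnderColimitsOfShape (Discrete J)] (Y : J → C) [HasCoproduct Y]
    (h : ∀ j, Q (Y j)) : Q (∐ Y) :=
  Q.prop_colimit _ (fun j => h j.as)

/-- The Eilenberg swindle: `X ⊕ Y^(ℕ) ≅ Y^(ℕ)` if `X` is a retract of `Y`. -/
theorem prop_of_retract_of_coproducts [HasCoproductsOfShape ℕ C] {Q : ObjectProperty C}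
    [Q.IsClosedUnderIsomorphisms] [Q.IsTriangulated]
    [Q.IsClosedUnderColimitsOfShape (Discrete ℕ)] {X Y : C} (i : X ⟶ Y) (r : Y ⟶ X)
    (hir : i ≫ r = 𝟙 X) (hY : Q Y) : Q X := by
  let B : C := ∐ fun _ : ℕ => Y
  have hB : Q B := IsClosedUnderCoproducts.sigma _ fun _ => hY
  let ι : ℕ → (Y ⟶ B) := Sigma.ι fun _ : ℕ => Y
  let e : Y ⟶ Y := r ≫ i
  have he : e ≫ e = e := by simp [e, reassoc_of% hir]
  -- Think of `Y` as `X ⊕ X'` through the idempotent `e`. Then `f` fixes every copy of `X'` and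
  -- moves each copy of `X` one place up, and `ρ` moves it back. So `f` is a split monomorphism
  -- whose complement is the copy of `X` in place `0`, and its cone will be `X`.
  let f : B ⟶ B := Sigma.desc fun n => (𝟙 Y - e) ≫ ι n + e ≫ ι (n + 1)
  let ρ : B ⟶ B := Sigma.desc fun n =>
    (𝟙 Y - e) ≫ ι n + e ≫ (Nat.casesOn n 0 ι : Y ⟶ B)
  let p : B ⟶ X := Sigma.desc fun n => (Nat.casesOn n r 0 : Y ⟶ X)
  let s : X ⟶ B := i ≫ ι 0
  have ιf (n : ℕ) : ι n ≫ f = (𝟙 Y - e) ≫ ι n + e ≫ ι (n + 1) := Sigma.ι_desc _ _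
  have ιρ0 : ι 0 ≫ ρ = (𝟙 Y - e) ≫ ι 0 := by simp [ι, ρ]
  have ιρ (n : ℕ) : ι (n + 1) ≫ ρ = (𝟙 Y - e) ≫ ι (n + 1) + e ≫ ι n := by simp [ι, ρ]
  have ιp0 : ι 0 ≫ p = r := by simp [ι, p]
  have ιp (n : ℕ) : ι (n + 1) ≫ p = 0 := by simp [ι, p]
  have hext {W : C} {a b : B ⟶ W} (h : ∀ n, ι n ≫ a = ι n ≫ b) : a = b :=
    Sigma.hom_ext _ _ h
  have hsp : s ≫ p = 𝟙 X := by simp [s, ιp0, hir]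
  have hfρ : f ≫ ρ = 𝟙 B := hext fun n => by
    rw [reassoc_of% ιf]
    cases n <;> simp [ιρ0, ιρ, reassoc_of% he]
  have hρf : ρ ≫ f + p ≫ s = 𝟙 B := hext fun n => by
    cases n <;>
    simp [reassoc_of% ιρ0, reassoc_of% ιρ, reassoc_of% ιp0, reassoc_of% ιp, ιf, s, e,
      reassoc_of% hir]
  have hfp : f ≫ p = 0 := hext fun n => by
    rw [reassoc_of% ιf]
    cases n <;> simp [ιp0, ιp, e, hir]
  obtain ⟨Z, g, h, hT⟩ := distinguished_cocone_triangle f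
  have hZ : Q Z := Q.ext_of_isTriangulatedClosed₃ _ hT hB hB
  have h0 : h = 0 := by
    have : h ≫ f⟦(1 : ℤ)⟧' = 0 := comp_distTriang_mor_zero₃₁ _ hT
    rw [← cancel_mono ((shiftFunctor C (1 : ℤ)).map (𝟙 B)), ← hfρ, Functor.map_comp,
      reassoc_of% this]
    simp
  have hg : Epi g := Triangle.epi₂ _ hT h0
  obtain ⟨p', hp'⟩ : ∃ p' : Z ⟶ X, p = g ≫ p' := Triangle.yoneda_exact₂ _ hT p hfp
  have hfg : f ≫ g = 0 := comp_distTriang_mor_zero₁₂ _ hT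
  refine Q.prop_of_iso (⟨p', s ≫ g, ?_, ?_⟩ : Z ≅ X) hZ
  · rw [← cancel_epi g, ← reassoc_of% hp', ← Category.assoc p, ← add_sub_cancel_left (ρ ≫ f) (p ≫
      s),
      hρf]
    simp [hfg]
  · rw [Category.assoc, ← hp', hsp]

lemma IsLocalizing.isThick [HasCoproducts.{w} C] {Q : ObjectProperty C}
    (hQ : IsLocalizing.{w} Q) : IsThick Q where
  triangulated := hQ.triangulated
  retracts := ⟨fun {X Y} h hY => by
    have := hQ.isoClosed
    have := hQ.triangulated
    have := hQ.coproducts.nat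
    have := hasCoproducts_nat.{w} (C := C)
    exact prop_of_retract_of_coproducts h.i h.r h.retract hY⟩

lemma IsLocalizing.isCocompletePreaisle {Q : ObjectProperty C}
    (hQ : IsLocalizing.{w} Q) : IsCocompletePreaisle.{w} Q where
  isoClosed := hQ.isoClosed
  zero := hQ.triangulated.toContainsZero
  shift := hQ.triangulated.toIsStableUnderShift.isStableUnderShiftBy 1
  extensions := hQ.triangulated.toIsTriangulatedClosed₂
  coproducts := hQ.coproducts

lemma IsThick.isSuspended {Q : ObjectProperty C} (hQ : IsThick Q) : IsSuspended Q where
  isoClosed := have := hQ.retracts; inferInstance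
  zero := hQ.triangulated.toContainsZero
  shift := hQ.triangulated.toIsStableUnderShift.isStableUnderShiftBy 1
  extensions := hQ.triangulated.toIsTriangulatedClosed₂
  retracts := hQ.retracts

/-- The thick subcategory generated by `P` is contained in the localizing one. -/
lemma localizing_thick_inf_le [HasCoproducts.{w} C] (P K : ObjectProperty C) :
    localizing.{w} (thick P ⊓ K) ≤ localizing.{w} P :=
  fun _ hX Q hQ hPQ => hX Q hQ fun _ hY => hY.1 Q hQ.isThick hPQ

/-- Every localizing subcategory is a cocomplete preaisle and every thick one is suspended, so
membership in the `t`-version can be tested on localizing and thick subcategories. The other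
inclusion holds for every `P`, since the swindle makes localizing subcategories thick. -/
theorem IsTProxySmall.isProxySmall [HasCoproducts.{w} C] {P : ObjectProperty C}
    (hP : IsTProxySmall.{w} P) : IsProxySmall.{w} P := by
  refine le_antisymm (fun X hX Q hQ hPQ => hX Q hQ fun Y hY => ?_) (localizing_thick_inf_le _ _)
  have hY' : cocompletePreaisle.{w} P Y := fun _ _ h => h _ hY
  rw [IsTProxySmall] at hP
  rw [hP] at hY'
  exact hY' Q hQ.isCocompletePreaisle fun Z hZ =>
    hPQ _ ⟨fun Q' hQ' h => hZ.1 Q' hQ'.isSuspended h, hZ.2⟩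

open Pretriangulated.Opposite Opposite in
/-- The morphisms whose cone lies in a localizing subcategory are stable under coproducts. -/
lemma trW_sigmaMap {J : Type*} {Q : ObjectProperty C} [Q.IsClosedUnderIsomorphisms]
    [HasCoproductsOfShape J C]
    [Q.IsTriangulated] [Q.IsClosedUnderColimitsOfShape (Discrete J)] {X Y : J → C}
    (f : ∀ j, X j ⟶ Y j) (hf : ∀ j, Q.trW (f j)) : Q.trW (Limits.Sigma.map f) := by
  -- A product of distinguished triangles is distinguished; passing to the opposite category turns
  -- this into the statement for coproducts.
  have : Q.IsClosedUnderColimitsOfShape (Discrete J)ᵒᵖ :=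
    .of_equivalence (J := Discrete J) (Discrete.opposite J).symm
  have h : Q.op.trW.IsStableUnderProductsOfShape J :=
    MorphismProperty.IsStableUnderProductsOfShape.mk _ _ fun X₁ X₂ _ _ f hf =>
      ObjectProperty.trW.mk _ (productTriangle_distinguished _
        (fun j => (hf j).choose_spec.choose_spec.choose_spec.choose))
        (Q.op.prop_pi _ (fun j => (hf j).choose_spec.choose_spec.choose_spec.choose_spec))
  have hf' (j : J) : Q.op.trW (f j).op := (Q.trW_op_iff).2 (hf j)
  refine (Q.trW_op_iff (f := (Limits.Sigma.map f).op)).1 ?_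
  exact h.condition _ _ _ _ (Cofan.IsColimit.op (coproductIsCoproduct Y))
    (Cofan.IsColimit.op (coproductIsCoproduct X))
    (Discrete.natTrans fun j => (f j.as).op) (fun j => hf' j.as) _ (fun ⟨j⟩ => by
      apply Quiver.Hom.unop_inj
      simp)

/-- The telescope `1 - φ` on the coproduct of a sequence. -/
noncomputable def telescope {Z : ℕ → C} (z : ∀ n, Z n ⟶ Z (n + 1)) [HasCoproduct Z] :
    ∐ Z ⟶ ∐ Z :=
  𝟙 _ - Limits.Sigma.desc fun n => z n ≫ Sigma.ι Z (n + 1)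

/-- The composite transition maps `Z 0 ⟶ Z n` of a sequence. -/
def fromZero {Z : ℕ → C} (z : ∀ n, Z n ⟶ Z (n + 1)) : ∀ n, Z 0 ⟶ Z n
  | 0 => 𝟙 _
  | n + 1 => fromZero z n ≫ z n

/-- By the octahedral axiom the cones of `f`, `f ≫ g` and `g` form a distinguished triangle, so two
of them in `Q` force the third. -/
lemma trW_of_postcomp [IsTriangulated C] {Q : ObjectProperty C} [Q.IsTriangulated]
    [Q.IsClosedUnderIsomorphisms] {X Y Z : C} (f : X ⟶ Y) (g : Y ⟶ Z) (hg : Q.trW g)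
    (hfg : Q.trW (f ≫ g)) : Q.trW f := by
  obtain ⟨A, a, a', hA⟩ := distinguished_cocone_triangle f
  obtain ⟨B, b, b', hB, hQB⟩ := hg
  obtain ⟨D, d, d', hD, hQD⟩ := hfg
  exact ⟨A, a, a', hA,
    Q.ext_of_isTriangulatedClosed₁ _ (Triangulated.someOctahedron rfl hA hB hD).mem hQD hQB⟩

/-- If a sequence with vanishing homotopy colimit is made of isomorphisms modulo a localizing
subcategory, then its first object lies in that subcategory. -/
theorem prop_zero_of_isIso_telescope [IsTriangulated C] [HasCoproductsOfShape ℕ C]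
    {Q : ObjectProperty C}
    [Q.IsClosedUnderIsomorphisms] [Q.IsTriangulated]
    [Q.IsClosedUnderColimitsOfShape (Discrete ℕ)] {Z : ℕ → C} (z : ∀ n, Z n ⟶ Z (n + 1))
    (hz : ∀ n, Q.trW (z n)) [IsIso (telescope z)] : Q (Z 0) := by
  have ha (n : ℕ) : Q.trW (fromZero z n) := by
    induction n with
    | zero => exact Q.trW.id_mem _
    | succ n ih => exact Q.trW.comp_mem _ _ ih (hz n)
  -- The transition maps compare the constant sequence `Z 0` with `Z` by isomorphisms modulo `Q`. As
  -- `telescope z` is invertible, the telescope `t` of the constant sequence has its cone in `Q`.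
  let W : ℕ → C := fun _ => Z 0
  let t : ∐ W ⟶ ∐ W := telescope fun n => 𝟙 (W n)
  have hιt (n : ℕ) : Sigma.ι W n ≫ t = Sigma.ι W n - Sigma.ι W (n + 1) := by
    simp [t, telescope]
  let a : ∐ W ⟶ ∐ Z := Limits.Sigma.map (fromZero z)
  have hcomm : t ≫ a = a ≫ telescope z := Sigma.hom_ext _ _ fun n => by
    simp [t, a, telescope, fromZero, W]
  have hta : Q.trW t := by
    refine trW_of_postcomp t a (trW_sigmaMap _ ha) ?_
    rw [hcomm]
    exact Q.trW.comp_mem _ _ (trW_sigmaMap _ ha) (Q.trW_of_isIso _)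
  obtain ⟨K, g, h, hT, hK⟩ := hta
  -- The codiagonal kills `t`, so it factors through the cone `K`; any inclusion of `Z 0` splits it,
  -- which makes `Z 0` a retract of `K`.
  let c : ∐ W ⟶ Z 0 := Limits.Sigma.desc fun _ => 𝟙 (Z 0)
  have hc (n : ℕ) : Sigma.ι W n ≫ c = 𝟙 (Z 0) := Sigma.ι_desc _ _
  have htc : t ≫ c = 0 := Sigma.hom_ext _ _ fun n => by
    rw [reassoc_of% hιt n, Preadditive.sub_comp, hc, hc, sub_self, comp_zero]
  obtain ⟨p, hp⟩ : ∃ p : K ⟶ Z 0, c = g ≫ p := Triangle.yoneda_exact₂ _ hT c htc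
  exact prop_of_retract_of_coproducts (Sigma.ι W 0 ≫ g) p
    (by rw [Category.assoc, ← hp, hc]) hK

/-- A morphism from a compact object to a coproduct has only finitely many nonzero components. -/
lemma IsCompact.finite_support {X : C} (hX : IsCompact.{w} X) {J : Type w} {Y : J → C}
    [HasCoproduct Y] (f : X ⟶ ∐ Y) : ∃ s : Finset J, ∀ j ∉ s, ∀ g : ∐ Y ⟶ Y j,
      (∀ i ≠ j, Sigma.ι Y i ≫ g = 0) → f ≫ g = 0 := by
  classical
  obtain ⟨y, rfl⟩ := (hX J Y _ ⟨coproductIsCoproduct Y⟩).2 f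
  refine ⟨y.support, fun j hj g hg => ?_⟩
  rw [← DirectSum.sum_support_of y, map_sum, Preadditive.sum_comp]
  refine Finset.sum_eq_zero fun i hi => ?_
  rw [DirectSum.toAddMonoid_of]
  change (y i ≫ Sigma.ι Y i) ≫ g = 0
  rw [Category.assoc, hg i (fun h => hj (h ▸ hi)), comp_zero]

/-- If the homotopy colimit of a sequence starting with a compact object vanishes, then so does
some composite of its transition maps. -/
theorem exists_fromZero_eq_zero [HasCoproducts.{w} C] [HasCoproductsOfShape ℕ C] {Z : ℕ → C}
    (z : ∀ n, Z n ⟶ Z (n + 1))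
    (hc : IsCompact.{w} (Z 0)) [IsIso (telescope z)] (m : ℕ) : ∃ n ≥ m, fromZero z n = 0 := by
  classical
  -- Compactness speaks of families indexed by types in universe `w`, hence the lifted copy of the
  -- coproduct.
  let e : ULift.{w} ℕ ≃ ℕ := Equiv.ulift
  let Z' : ULift.{w} ℕ → C := fun n => Z n.down
  let α : ∐ Z ⟶ ∐ Z' := Limits.Sigma.desc fun n => Sigma.ι Z' ⟨n⟩
  let π (k : ℕ) : ∐ Z ⟶ Z k :=
    Limits.Sigma.desc fun n => if h : n = k then eqToHom (by rw [h]) else 0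
  let π' (k : ℕ) : ∐ Z' ⟶ Z k :=
    Limits.Sigma.desc fun n => if h : n.down = k then eqToHom (by rw [← h]) else 0
  have hπ (k : ℕ) : α ≫ π' k = π k := Sigma.hom_ext _ _ fun n => by simp [α, π, π']
  -- Solving `g ≫ (1 - φ) = ι 0` component by component is a geometric series: the `k`-th component
  -- of `g` must be the composite `Z 0 ⟶ Z k`. Compactness allows only finitely many of these to be
  -- nonzero.
  let g : Z 0 ⟶ ∐ Z := Sigma.ι Z 0 ≫ inv (telescope z)
  have hg : g ≫ telescope z = Sigma.ι Z 0 := by simp [g]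
  have hπ0 : telescope z ≫ π 0 = π 0 := Sigma.hom_ext _ _ fun n => by
    simp [telescope, π]
  have hπs (k : ℕ) : telescope z ≫ π (k + 1) = π (k + 1) - π k ≫ z k :=
    Sigma.hom_ext _ _ fun n => by
      by_cases h : n = k
      · subst h; simp [telescope, π]
      · simp [telescope, π, h]
  have hk (k : ℕ) : g ≫ π k = fromZero z k := by
    induction k with
    | zero => rw [← hπ0, reassoc_of% hg]; simp [π, fromZero]
    | succ k ih =>
      have := hg =≫ π (k + 1)
      rw [Category.assoc, hπs] at this
      simp only [Preadditive.comp_sub, ← Category.assoc, ih] at this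
      rw [fromZero, ← sub_eq_zero, this]
      simp [π]
  obtain ⟨s, hs⟩ := hc.finite_support (g ≫ α)
  obtain ⟨n, hn⟩ := (s.image ULift.down ∪ Finset.range m).exists_notMem
  simp only [Finset.mem_union, Finset.mem_image, Finset.mem_range, not_or, not_exists, not_and,
    not_lt] at hn
  refine ⟨n, hn.2, ?_⟩
  rw [← hk, ← hπ, ← Category.assoc]
  refine hs ⟨n⟩ (fun h => hn.1 _ h rfl) _ fun i hi => ?_
  have : i.down ≠ n := fun h => hi (ULift.ext _ _ h)
  simp [π', this]

end Triangulated

/-! ### Coproducts in the derived category -/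

section ComplexCoproduct

variable {S : Type u} [CommRing S] {J : Type u}

open Classical in
/-- The projection of a coproduct of complexes to a finite subsum, as an endomorphism. -/
noncomputable def partialSum (K : J → CochainComplex (ModuleCat.{u} S) ℤ) (s : Finset J) :
    ∐ K ⟶ ∐ K :=
  ∑ j ∈ s, Sigma.π K j ≫ Sigma.ι K j

lemma ι_partialSum (K : J → CochainComplex (ModuleCat.{u} S) ℤ) (s : Finset J) {i : J}
    (hi : i ∈ s) : Sigma.ι K i ≫ partialSum K s = Sigma.ι K i := by
  classical
  rw [partialSum, Preadditive.comp_sum, Finset.sum_eq_single_of_mem i hi]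
  · simp
  · intro j _ hj
    rw [Sigma.ι_π_of_ne_assoc _ hj.symm, zero_comp]

/-- Evaluation in degree `n` preserves coproducts, so the quotient by the sum of the images of the
summands is zero; hence every element is a finite sum of elements from summands. -/
lemma exists_partialSum_f_apply (K : J → CochainComplex (ModuleCat.{u} S) ℤ) (n : ℤ)
    (z : (∐ K).X n) : ∃ s : Finset J, ∀ s' ⊇ s, (partialSum K s').f n z = z := by
  classical
  let N : Submodule S ((∐ K).X n) := ⨆ j, LinearMap.range ((Sigma.ι K j).f n).hom
  have hN : N = ⊤ := by
    rw [← Submodule.ker_mkQ N, LinearMap.ker_eq_top]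
    have hc := isColimitOfPreserves
      (HomologicalComplex.eval (ModuleCat.{u} S) (ComplexShape.up ℤ) n) (coproductIsCoproduct K)
    suffices ModuleCat.ofHom N.mkQ = 0 by
      exact congrArg ModuleCat.Hom.hom this
    refine hc.hom_ext fun ⟨j⟩ => ?_
    ext y
    exact (Submodule.Quotient.mk_eq_zero _).2
      (le_iSup (fun j => LinearMap.range ((Sigma.ι K j).f n).hom) j ⟨y, rfl⟩)
  have hz : z ∈ N := hN ▸ Submodule.mem_top
  refine Submodule.iSup_induction (fun j => LinearMap.range ((Sigma.ι K j).f n).hom)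
    (motive := fun z => ∃ s : Finset J, ∀ s' ⊇ s, (partialSum K s').f n z = z) hz ?_ ?_ ?_
  · rintro j _ ⟨y, rfl⟩
    refine ⟨{j}, fun s' hs' => ?_⟩
    have := congrArg (fun f => f.f n) (ι_partialSum K s' (hs' (Finset.mem_singleton_self j)))
    exact congrArg (fun f => f y) (congrArg (fun f => f.hom) this)
  · exact ⟨∅, fun _ _ => map_zero _⟩
  · rintro x y ⟨s, hs⟩ ⟨t, ht⟩
    refine ⟨s ∪ t, fun s' hs' => ?_⟩
    rw [map_add, hs _ (Finset.union_subset_left hs'), ht _ (Finset.union_subset_right hs')]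

lemma exists_homologyMap_partialSum_apply (K : J → CochainComplex (ModuleCat.{u} S) ℤ) (n : ℤ)
    (h : (∐ K).homology n) :
    ∃ s : Finset J, HomologicalComplex.homologyMap (partialSum K s) n h = h := by
  obtain ⟨x, rfl⟩ := (ModuleCat.epi_iff_surjective ((∐ K).homologyπ n)).1 inferInstance h
  obtain ⟨s, hs⟩ := exists_partialSum_f_apply K n ((∐ K).iCycles n x)
  refine ⟨s, ?_⟩
  have h1 : HomologicalComplex.cyclesMap (partialSum K s) n x = x := by
    apply (ModuleCat.mono_iff_injective ((∐ K).iCycles n)).1 inferInstance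
    rw [← ConcreteCategory.comp_apply, HomologicalComplex.cyclesMap_i, ConcreteCategory.comp_apply,
      hs s (Finset.Subset.refl _)]
  rw [← ConcreteCategory.comp_apply, HomologicalComplex.homologyπ_naturality,
    ConcreteCategory.comp_apply, h1]

open Classical in
lemma homologyMap_partialSum (K : J → CochainComplex (ModuleCat.{u} S) ℤ) (s : Finset J) (n : ℤ) :
    HomologicalComplex.homologyMap (partialSum K s) n = ∑ j ∈ s,
      HomologicalComplex.homologyMap (Sigma.π K j) n ≫
        HomologicalComplex.homologyMap (Sigma.ι K j) n := by
  change (HomologicalComplex.homologyFunctor _ _ n).map _ = _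
  rw [partialSum, Functor.map_sum]
  exact Finset.sum_congr rfl fun j _ => HomologicalComplex.homologyMap_comp _ _ _

open Classical in
lemma homologyMap_partialSum_apply (K : J → CochainComplex (ModuleCat.{u} S) ℤ) (s : Finset J)
    (n : ℤ) (h : (∐ K).homology n) :
    HomologicalComplex.homologyMap (partialSum K s) n h = ∑ j ∈ s,
        HomologicalComplex.homologyMap (Sigma.ι K j) n
          (HomologicalComplex.homologyMap (Sigma.π K j) n h) := by
  rw [homologyMap_partialSum]
  refine (LinearMap.congr_fun (ModuleCat.hom_sum _ _) h).trans ?_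
  rw [LinearMap.sum_apply]
  rfl

/-- A coproduct of quasi-isomorphisms is a quasi-isomorphism. -/
lemma quasiIso_sigmaMap {K L : J → CochainComplex (ModuleCat.{u} S) ℤ} (f : ∀ j, K j ⟶ L j)
    [hf : ∀ j, QuasiIso (f j)] : QuasiIso (Limits.Sigma.map f) := by
  classical
  rw [quasiIso_iff]
  intro n
  rw [quasiIsoAt_iff_isIso_homologyMap]
  have hf' (j : J) : Function.Bijective (HomologicalComplex.homologyMap (f j) n) :=
    (ConcreteCategory.isIso_iff_bijective _).1 inferInstance
  have hπ (j : J) : Limits.Sigma.map f ≫ Sigma.π L j = Sigma.π K j ≫ f j :=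
    Sigma.hom_ext _ _ fun i => by
      by_cases h : i = j
      · subst h; simp
      · simp [Sigma.ι_π_of_ne _ h, Sigma.ι_π_of_ne_assoc _ h]
  refine (ConcreteCategory.isIso_iff_bijective _).2 ⟨?_, fun h => ?_⟩
  · refine (injective_iff_map_eq_zero _).2 fun h hh => ?_
    obtain ⟨s, hs⟩ := exists_homologyMap_partialSum_apply K n h
    rw [← hs, homologyMap_partialSum_apply]
    refine Finset.sum_eq_zero fun j _ => ?_
    have : HomologicalComplex.homologyMap (Sigma.π K j) n h = 0 := by
      apply (hf' j).1
      rw [map_zero, ← ConcreteCategory.comp_apply, ← HomologicalComplex.homologyMap_comp, ← hπ,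
        HomologicalComplex.homologyMap_comp, ConcreteCategory.comp_apply, hh, map_zero]
    rw [this, map_zero]
  · obtain ⟨s, hs⟩ := exists_homologyMap_partialSum_apply L n h
    rw [homologyMap_partialSum_apply] at hs
    choose y hy using fun j => (hf' j).2 (HomologicalComplex.homologyMap (Sigma.π L j) n h)
    refine ⟨∑ j ∈ s, HomologicalComplex.homologyMap (Sigma.ι K j) n (y j), ?_⟩
    rw [← hs, map_sum]
    refine Finset.sum_congr rfl fun j _ => ?_
    rw [← hy, ← ConcreteCategory.comp_apply, ← ConcreteCategory.comp_apply,
      ← HomologicalComplex.homologyMap_comp, ← HomologicalComplex.homologyMap_comp,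
      Sigma.ι_map]

open DerivedCategory

/-- The cofan in the derived category given by a coproduct of complexes. -/
noncomputable def derivedCofan (K : J → CochainComplex (ModuleCat.{u} S) ℤ) :
    Cofan fun j => Q.obj (K j) :=
  Cofan.mk (Q.obj (∐ K)) fun j => Q.map (Sigma.ι K j)

/-- Each `f j` is a fraction with a quasi-isomorphism `s j` as denominator. The coproduct of the `s
j` is again a quasi-isomorphism and serves as a common denominator. -/
lemma derivedCofan_exists_desc (K : J → CochainComplex (ModuleCat.{u} S) ℤ) {Z : D S}
    (f : ∀ j, Q.obj (K j) ⟶ Z) : ∃ g : Q.obj (∐ K) ⟶ Z, ∀ j, Q.map (Sigma.ι K j) ≫ g = f j := by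
  obtain ⟨L, ⟨e⟩⟩ : ∃ L : CochainComplex (ModuleCat.{u} S) ℤ, Nonempty (Q.obj L ≅ Z) :=
    ⟨_, ⟨Q.objObjPreimageIso Z⟩⟩
  choose K' s hs g hg using fun j => right_fac (f j ≫ e.inv)
  have hs' (j : J) : QuasiIso (s j) := (isIso_Q_map_iff_quasiIso _ _).1 (hs j)
  have := quasiIso_sigmaMap s
  refine ⟨inv (Q.map (Limits.Sigma.map s)) ≫ Q.map (Limits.Sigma.desc g) ≫ e.hom, fun j => ?_⟩
  rw [← cancel_epi (Q.map (s j)), ← Functor.map_comp_assoc, ← Sigma.ι_map, Functor.map_comp_assoc,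
    IsIso.hom_inv_id_assoc, ← Functor.map_comp_assoc, Sigma.ι_desc]
  have := hg j
  rw [IsIso.eq_inv_comp] at this
  rw [← this]
  simp

lemma homology_sigma_hom_ext (K : J → CochainComplex (ModuleCat.{u} S) ℤ) (n : ℤ)
    {M : ModuleCat.{u} S} {f g : (∐ K).homology n ⟶ M}
    (h : ∀ j, HomologicalComplex.homologyMap (Sigma.ι K j) n ≫ f =
      HomologicalComplex.homologyMap (Sigma.ι K j) n ≫ g) : f = g := by
  ext x
  obtain ⟨s, hs⟩ := exists_homologyMap_partialSum_apply K n x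
  rw [← hs, homologyMap_partialSum_apply, map_sum, map_sum]
  refine Finset.sum_congr rfl fun j _ => ?_
  rw [← ConcreteCategory.comp_apply, h]
  rfl

lemma homologyFunctor_jointly_epi (K : J → CochainComplex (ModuleCat.{u} S) ℤ) (n : ℤ)
    {M : ModuleCat.{u} S} {f g : (homologyFunctor _ n).obj (Q.obj (∐ K)) ⟶ M}
    (h : ∀ j, (homologyFunctor _ n).map (Q.map (Sigma.ι K j)) ≫ f =
      (homologyFunctor _ n).map (Q.map (Sigma.ι K j)) ≫ g) : f = g := by
  rw [← cancel_epi ((homologyFunctorFactors _ n).inv.app (∐ K))]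
  refine homology_sigma_hom_ext K n fun j => ?_
  have := (homologyFunctorFactors (ModuleCat.{u} S) n).inv.naturality (Sigma.ι K j)
  have key (φ : (homologyFunctor _ n).obj (Q.obj (∐ K)) ⟶ M) :=
    (Category.assoc _ _ _).symm.trans ((this =≫ φ).trans (Category.assoc _ _ _))
  exact (key f).trans ((congrArg _ (h j)).trans (key g).symm)

/-- The localization functor to the derived category preserves coproducts. -/
theorem nonempty_isColimit_derivedCofan (K : J → CochainComplex (ModuleCat.{u} S) ℤ) :
    Nonempty (IsColimit (derivedCofan K)) := by
  have huniq {Z : D S} (f : Q.obj (∐ K) ⟶ Z) (hf : ∀ j, Q.map (Sigma.ι K j) ≫ f = 0) : f = 0 := by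
    -- Uniqueness without calculus of fractions: the inclusions lift to the fibre `A` of `f` and
    -- assemble to `b`. The endomorphism `b ≫ i` fixes all inclusions, so it is the identity on
    -- homology, hence invertible; but `f` kills it.
    obtain ⟨A, i, δ, hT⟩ := Pretriangulated.distinguished_cocone_triangle₁ f
    have hif : i ≫ f = 0 := Pretriangulated.comp_distTriang_mor_zero₁₂ _ hT
    have hl (j : J) : ∃ a : Q.obj (K j) ⟶ A, Q.map (Sigma.ι K j) = a ≫ i :=
      Pretriangulated.Triangle.coyoneda_exact₂ _ hT _ (hf j)
    choose a ha using hl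
    obtain ⟨b, hb⟩ := derivedCofan_exists_desc K a
    have hbi (j : J) : Q.map (Sigma.ι K j) ≫ (b ≫ i) = Q.map (Sigma.ι K j) := by
      rw [← Category.assoc, hb]
      exact (ha j).symm
    have : IsIso (b ≫ i) := by
      rw [DerivedCategory.isIso_iff]
      intro n
      have : (homologyFunctor _ n).map (b ≫ i) = 𝟙 _ :=
        homologyFunctor_jointly_epi K n fun j => by
          rw [← Functor.map_comp, hbi, Category.comp_id]
      rw [this]
      infer_instance
    rw [← cancel_epi (b ≫ i), Category.assoc, hif, comp_zero, comp_zero]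
  have huniq' {Z : D S} (f g : Q.obj (∐ K) ⟶ Z)
      (h : ∀ j, Q.map (Sigma.ι K j) ≫ f = Q.map (Sigma.ι K j) ≫ g) : f = g :=
    sub_eq_zero.1 (huniq _ fun j => by rw [Preadditive.comp_sub, h, sub_self])
  choose g hg using fun (s : Cofan fun j => Q.obj (K j)) => derivedCofan_exists_desc K s.inj
  exact ⟨Cofan.IsColimit.mk _ g hg fun s m hm => huniq' m (g s) fun j => (hm j).trans (hg s j).symm⟩

instance : HasCoproducts.{u} (D S) := fun J => ⟨fun F => by
  let K : J → CochainComplex (ModuleCat.{u} S) ℤ := fun j => Q.objPreimage (F.obj ⟨j⟩)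
  let e : Discrete.functor (fun j => Q.obj (K j)) ≅ F :=
    Discrete.natIso fun j => Q.objObjPreimageIso (F.obj j)
  have : HasColimit (Discrete.functor fun j => Q.obj (K j)) :=
    ⟨_, (nonempty_isColimit_derivedCofan K).some⟩
  exact hasColimit_of_iso e.symm⟩

/-- The homology of a coproduct is generated by the homology of the summands. -/
lemma homologyFunctor_sigma_hom_ext (Y : J → D S) [HasCoproduct Y] (n : ℤ) {M : ModuleCat.{u} S}
    {f g : (homologyFunctor _ n).obj (∐ Y) ⟶ M}
    (h : ∀ j, (homologyFunctor _ n).map (Sigma.ι Y j) ≫ f =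
      (homologyFunctor _ n).map (Sigma.ι Y j) ≫ g) : f = g := by
  let K : J → CochainComplex (ModuleCat.{u} S) ℤ := fun j => Q.objPreimage (Y j)
  let e (j : J) : Q.obj (K j) ≅ Y j := Q.objObjPreimageIso (Y j)
  obtain ⟨a, ha⟩ := derivedCofan_exists_desc K fun j => (e j).hom ≫ Sigma.ι Y j
  let b : ∐ Y ⟶ Q.obj (∐ K) := Limits.Sigma.desc fun j => (e j).inv ≫ Q.map (Sigma.ι K j)
  have hba : b ≫ a = 𝟙 _ := Sigma.hom_ext _ _ fun j => by simp [b, ha]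
  have : Epi ((homologyFunctor (ModuleCat.{u} S) n).map a) :=
    @epi_of_epi_fac _ _ _ _ _ _ _ _ inferInstance (by rw [← Functor.map_comp, hba])
  rw [← cancel_epi ((homologyFunctor (ModuleCat.{u} S) n).map a)]
  refine homologyFunctor_jointly_epi K n fun j => ?_
  rw [← Functor.map_comp_assoc, ← Functor.map_comp_assoc, ha, Functor.map_comp_assoc,
    Functor.map_comp_assoc, h]

end ComplexCoproduct

/-! ### Compactness of the ring -/

section RingObject

open DerivedCategory

variable {S : Type u} [CommRing S]

/-- A projective module in a single degree is a K-projective complex, so maps out of it in the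
derived category are homotopy classes of chain maps. -/
lemma exists_eq_Q_map_of_projective (F : ModuleCat.{u} S) [Projective F] (n : ℤ)
    {K : CochainComplex (ModuleCat.{u} S) ℤ} (f : Q.obj ((HomologicalComplex.single _
        (ComplexShape.up ℤ) n).obj F) ⟶ Q.obj K) :
    ∃ φ : (HomologicalComplex.single _ (ComplexShape.up ℤ) n).obj F ⟶ K, f = Q.map φ := by
  let L : CochainComplex (ModuleCat.{u} S) ℤ :=
    (HomologicalComplex.single _ (ComplexShape.up ℤ) n).obj F
  have (i : ℤ) : Projective (L.X i) := by
    by_cases h : i = n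
    · subst h
      exact Projective.of_iso (HomologicalComplex.singleObjXSelf (ComplexShape.up ℤ) i F).symm ‹_›
    · exact Projective.of_iso (HomologicalComplex.isZero_single_obj_X
        (ComplexShape.up ℤ) n F i h).isoZero.symm inferInstance
  have : L.IsKProjective := CochainComplex.isKProjective_of_projective L n
  obtain ⟨g, hg⟩ := (CochainComplex.IsKProjective.Qh_map_bijective L _).2
    ((quotientCompQhIso _).hom.app L ≫ f ≫ (quotientCompQhIso _).inv.app K)
  obtain ⟨φ, rfl⟩ := (HomotopyCategory.quotient _ _).map_surjective g
  refine ⟨φ, ?_⟩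
  have h2 : Q.map φ = (quotientCompQhIso _).inv.app L ≫
      Qh.map ((HomotopyCategory.quotient _ _).map φ) ≫ (quotientCompQhIso _).hom.app K := by
    rw [quotientCompQhIso_hom_naturality, Iso.inv_hom_id_app_assoc]
  have h3 : f = (quotientCompQhIso _).inv.app L ≫ ((quotientCompQhIso _).hom.app L ≫ f ≫
      (quotientCompQhIso _).inv.app K) ≫ (quotientCompQhIso _).hom.app K := by
    simp
    rfl
  rw [h2, h3, ← hg]

variable (S) in
/-- The ring, as an object of its derived category. -/
noncomputable abbrev ringObj : D S := inDegreeZero S (ModuleCat.of S S)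

/-- The half of compactness that holds for every `X`: the projections of the coproduct recover the
components. -/
lemma directSum_toAddMonoid_injective {C : Type u₁} [Category.{v₁} C] [Preadditive C]
    {J : Type w} [DecidableEq J] (X : C) {Y : J → C} (c : Cofan Y) (hc : IsColimit c) :
    Function.Injective (DirectSum.toAddMonoid (fun j => Preadditive.rightComp X (c.inj j)) :
        (DirectSum J fun j => (X ⟶ Y j)) →+ (X ⟶ c.pt)) := by
  have key (j : J) : ∃ p : c.pt ⟶ Y j, c.inj j ≫ p = 𝟙 _ ∧ ∀ i ≠ j, c.inj i ≫ p = 0 :=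
    ⟨Cofan.IsColimit.desc hc fun i => if h : i = j then eqToHom (by rw [h]) else 0,
      by simp, fun i hi => by simp [hi]⟩
  choose p hp hp' using key
  have h (j : J) (y : DirectSum J fun j => (X ⟶ Y j)) :
      DirectSum.toAddMonoid (fun j => Preadditive.rightComp X (c.inj j)) y ≫ p j = y j := by
    induction y using DirectSum.induction_on with
    | zero => simp
    | add a b ha hb => rw [map_add, Preadditive.add_comp, ha, hb, DirectSum.add_apply]
    | of i a =>
      rw [DirectSum.toAddMonoid_of]
      change (a ≫ c.inj i) ≫ p j = _
      rw [Category.assoc]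
      by_cases hij : i = j
      · subst hij
        rw [hp, Category.comp_id, DirectSum.of_eq_same]
      · rw [hp' j i hij, comp_zero, DirectSum.of_eq_of_ne _ _ _ (Ne.symm hij)]
  intro y y' hy
  refine DFinsupp.ext fun j => ?_
  rw [← h j y, hy, h j y']

/-- The ring is a compact object of its derived category. -/
theorem isCompact_ringObj : IsCompact.{u} (ringObj S) := by
  intro J inst Y c ⟨hc⟩
  classical
  obtain rfl : inst = fun a b => Classical.propDecidable (a = b) := Subsingleton.elim _ _
  refine ⟨directSum_toAddMonoid_injective _ c hc, fun f => ?_⟩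
  let K : J → CochainComplex (ModuleCat.{u} S) ℤ := fun j => Q.objPreimage (Y j)
  let e (j : J) : Q.obj (K j) ≅ Y j := Q.objObjPreimageIso (Y j)
  obtain ⟨a, ha⟩ := derivedCofan_exists_desc K fun j => (e j).hom ≫ c.inj j
  let d : c.pt ⟶ Q.obj (∐ K) :=
    Cofan.IsColimit.desc hc fun j => (e j).inv ≫ Q.map (Sigma.ι K j)
  -- It is enough that `c.pt` is a retract of the coproduct of complexes.
  have hda : d ≫ a = 𝟙 _ := Cofan.IsColimit.hom_ext hc _ _ fun j => by simp [d, ha]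
  obtain ⟨φ, hφ⟩ := exists_eq_Q_map_of_projective (ModuleCat.of S S) 0 (f ≫ d)
  -- A chain map out of the ring is determined by the image of `1`, which lies in a finite subsum.
  obtain ⟨s, hs⟩ := exists_partialSum_f_apply K 0
    (((HomologicalComplex.singleObjXSelf (ComplexShape.up ℤ) 0 (ModuleCat.of S S)).inv ≫ φ.f 0)
      (1 : S))
  have hφs : φ ≫ partialSum K s = φ := by
    refine HomologicalComplex.from_single_hom_ext ?_
    rw [← cancel_epi (HomologicalComplex.singleObjXSelf (ComplexShape.up ℤ) 0
      (ModuleCat.of S S)).inv]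
    ext
    exact hs s (Finset.Subset.refl _)
  let ψ : ringObj S ⟶ Q.obj (∐ K) := Q.map φ
  have hψ : ψ = ∑ j ∈ s, (ψ ≫ Q.map (Sigma.π K j)) ≫ Q.map (Sigma.ι K j) := by
    have h1 : Q.map φ = Q.map φ ≫ Q.map (partialSum K s) := by rw [← Functor.map_comp, hφs]
    rw [partialSum, Functor.map_sum, Preadditive.comp_sum] at h1
    simp only [Functor.map_comp, ← Category.assoc] at h1
    exact h1
  have hf : f = ∑ j ∈ s, (ψ ≫ Q.map (Sigma.π K j) ≫ (e j).hom) ≫ c.inj j := by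
    have h1 : f = ψ ≫ a := by
      rw [← Category.comp_id f, ← hda, ← Category.assoc]
      exact congrArg (· ≫ a) hφ
    rw [h1]
    conv_lhs => rw [hψ, Preadditive.sum_comp]
    refine Finset.sum_congr rfl fun j _ => ?_
    simp [ha]
  refine ⟨∑ j ∈ s, DirectSum.of (fun j => ringObj S ⟶ Y j) j
    (ψ ≫ Q.map (Sigma.π K j) ≫ (e j).hom), ?_⟩
  rw [map_sum, hf]
  refine Finset.sum_congr rfl fun j _ => ?_
  rw [DirectSum.toAddMonoid_of]
  rfl

end RingObject

/-! ### Finiteness of cohomology and shifted free modules -/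

section Resolution

open DerivedCategory Pretriangulated

variable {S : Type u} [CommRing S]

/-- All cohomology modules are finitely generated. -/
def HasFiniteHomology : ObjectProperty (D S) := fun Z =>
  ∀ n : ℤ, Module.Finite S ((homologyFunctor (ModuleCat.{u} S) n).obj Z)

instance : (HasFiniteHomology (S := S)).IsClosedUnderIsomorphisms where
  of_iso e h n := by
    have := h n
    exact Module.Finite.equiv ((homologyFunctor _ n).mapIso e).toLinearEquiv

lemma finite_of_exact [IsNoetherianRing S] {A B C : ModuleCat.{u} S} {f : A ⟶ B} {g : B ⟶ C}
    {w : f ≫ g = 0} (h : (ShortComplex.mk f g w).Exact) (hA : Module.Finite S A)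
    (hC : Module.Finite S C) : Module.Finite S B := by
  have : IsNoetherian S C := isNoetherian_of_isNoetherianRing_of_finite S C
  have : IsNoetherian S A := isNoetherian_of_isNoetherianRing_of_finite S A
  have h' : LinearMap.range f.hom = LinearMap.ker g.hom := h.moduleCat_range_eq_ker
  have := isNoetherian_of_range_eq_ker f.hom g.hom h'
  infer_instance

instance [IsNoetherianRing S] : (HasFiniteHomology (S := S)).IsTriangulated where
  exists_zero := ⟨_, isZero_zero _, fun n => by
    have := ModuleCat.subsingleton_of_isZero
      ((homologyFunctor (ModuleCat.{u} S) n).map_isZero (isZero_zero (D S)))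
    infer_instance⟩
  isStableUnderShiftBy a := ⟨fun Z hZ n => by
    have : Module.Finite S (((homologyFunctor (ModuleCat.{u} S) 0).shift (a + n)).obj Z) :=
      hZ (a + n)
    exact Module.Finite.equiv
      (((homologyFunctor (ModuleCat.{u} S) 0).shiftIso a n (a + n) rfl).app Z).symm.toLinearEquiv⟩
  toIsTriangulatedClosed₂ := .mk' fun T hT h₁ h₃ n =>
    finite_of_exact (HomologySequence.exact₂ T hT n) (h₁ n) (h₃ n)

lemma hasFiniteHomology_singleFunctor (M : ModuleCat.{u} S) [Module.Finite S M] (m : ℤ) :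
    HasFiniteHomology ((singleFunctor _ m).obj M) := fun n => by
  by_cases h : n = m
  · subst h
    let e : (homologyFunctor _ n).obj ((singleFunctor _ n).obj M) ≅ M :=
      (singleFunctorCompHomologyFunctorIso _ n).app M
    exact Module.Finite.equiv e.symm.toLinearEquiv
  · have : IsZero ((homologyFunctor _ n).obj ((singleFunctor _ m).obj M)) := by
      rcases lt_or_gt_of_ne h with h | h
      · exact isZero_of_isGE _ m n h
      · exact isZero_of_isLE _ m n h
    have := ModuleCat.subsingleton_of_isZero this
    infer_instance

/-- The homology of the image of a complex in the derived category. -/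
noncomputable def homologyQIso (K : CochainComplex (ModuleCat.{u} S) ℤ) (n : ℤ) :
    (homologyFunctor _ n).obj (Q.obj K) ≅ K.homology n :=
  (homologyFunctorFactors _ n).app K

lemma homologyQIso_naturality {K L : CochainComplex (ModuleCat.{u} S) ℤ} (f : K ⟶ L) (n : ℤ) :
    (homologyFunctor _ n).map (Q.map f) ≫ (homologyQIso L n).hom =
      (homologyQIso K n).hom ≫ HomologicalComplex.homologyMap f n :=
  (homologyFunctorFactors _ n).hom.naturality f

/-- Every cohomology class of degree `n` comes from a shifted copy of the ring. -/
lemma exists_map_of_homology {Z : D S} (n : ℤ) (h : (homologyFunctor (ModuleCat.{u} S) n).obj Z) :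
    ∃ f : (singleFunctor _ n).obj (ModuleCat.of S S) ⟶ Z, ∃ y, (homologyFunctor _ n).map f y = h
        := by
  obtain ⟨K, ⟨e⟩⟩ : ∃ K : CochainComplex (ModuleCat.{u} S) ℤ, Nonempty (Q.obj K ≅ Z) :=
    ⟨_, ⟨Q.objObjPreimageIso Z⟩⟩
  let i : (homologyFunctor _ n).obj Z ≅ K.homology n :=
    (homologyFunctor _ n).mapIso e.symm ≪≫ homologyQIso K n
  obtain ⟨x, hx⟩ := (ModuleCat.epi_iff_surjective (K.homologyπ n)).1 inferInstance (i.hom h)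
  let a : ModuleCat.of S S ⟶ K.cycles n := ModuleCat.ofHom (LinearMap.toSpanSingleton S _ x)
  let ψ : (HomologicalComplex.single _ (ComplexShape.up ℤ) n).obj (ModuleCat.of S S) ⟶ K :=
    HomologicalComplex.mkHomFromSingle (a ≫ K.iCycles n) (by simp)
  have hψ : (HomologicalComplex.singleObjCyclesSelfIso (ComplexShape.up ℤ) n _).inv ≫
      HomologicalComplex.cyclesMap ψ n = a := by
    rw [← cancel_mono (K.iCycles n), Category.assoc, HomologicalComplex.cyclesMap_i,
      HomologicalComplex.singleObjCyclesSelfIso_inv_iCycles_assoc]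
    simp [ψ]
  have hψ' : (HomologicalComplex.singleObjHomologySelfIso (ComplexShape.up ℤ) n _).inv ≫
      HomologicalComplex.homologyMap ψ n = a ≫ K.homologyπ n := by
    rw [← hψ, Category.assoc, ← HomologicalComplex.homologyπ_naturality,
      HomologicalComplex.singleObjCyclesSelfIso_inv_homologyπ_assoc]
  let ψQ : (singleFunctor _ n).obj (ModuleCat.of S S) ⟶ Q.obj K := Q.map ψ
  let b : ModuleCat.of S S ⟶ (homologyFunctor _ n).obj ((singleFunctor _ n).obj (ModuleCat.of S
      S)) :=
    (HomologicalComplex.singleObjHomologySelfIso (ComplexShape.up ℤ) n _).inv ≫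
      (homologyQIso _ n).inv
  have h1 : (homologyFunctor _ n).map (ψQ ≫ e.hom) ≫ i.hom =
      (homologyFunctor _ n).map (Q.map ψ) ≫ (homologyQIso K n).hom := by
    simp only [i, Iso.trans_hom, Functor.mapIso_hom, Iso.symm_hom, ← Functor.map_comp_assoc,
      Category.assoc, Iso.hom_inv_id, Category.comp_id]
    rfl
  have hb : b ≫ (homologyFunctor _ n).map (ψQ ≫ e.hom) ≫ i.hom = a ≫ K.homologyπ n := by
    rw [h1, homologyQIso_naturality, ← hψ']
    exact (Category.assoc _ _ _).trans (congrArg _ (Iso.inv_hom_id_assoc _ _))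
  refine ⟨ψQ ≫ e.hom, b (1 : S), ?_⟩
  apply (ConcreteCategory.bijective_of_isIso i.hom).1
  rw [← hx, ← ConcreteCategory.comp_apply, ← ConcreteCategory.comp_apply, hb]
  change K.homologyπ n ((1 : S) • x) = _
  rw [one_smul]

lemma isZero_obj_biproduct {C₁ C₂ : Type*} [Category C₁] [Category C₂] [Preadditive C₁]
    [Preadditive C₂] (F : C₁ ⥤ C₂) [F.Additive] {r : ℕ} (X : Fin r → C₁) [HasBiproduct X]
    (h : ∀ j, IsZero (F.obj (X j))) : IsZero (F.obj (⨁ X)) := by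
  rw [IsZero.iff_id_eq_zero, ← F.map_id, ← biproduct.total, Functor.map_sum]
  refine Finset.sum_eq_zero fun j _ => ?_
  rw [Functor.map_comp, (h j).eq_of_src (F.map (biproduct.ι X j)) 0, comp_zero]

variable (S) in
/-- The shifted finite free module `S^r[-n]`. -/
noncomputable abbrev shiftedFree (n : ℤ) (r : ℕ) : D S :=
  ⨁ fun _ : Fin r => (singleFunctor (ModuleCat.{u} S) n).obj (ModuleCat.of S S)

instance (n : ℤ) (r : ℕ) : (shiftedFree S n r).IsLE n := by
  rw [isLE_iff]
  intro i hi
  exact isZero_obj_biproduct _ _ fun _ => isZero_of_isLE _ n i hi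

lemma prop_shiftedFree {P : ObjectProperty (D S)} [P.IsTriangulated] [P.IsClosedUnderIsomorphisms]
    {n : ℤ} (h : P ((singleFunctor _ n).obj (ModuleCat.of S S))) (r : ℕ) :
    P (shiftedFree S n r) :=
  P.prop_of_iso (biproduct.isoProduct _).symm (P.prop_pi _ fun _ => h)

end Resolution

/-! ### Free resolutions as sequences with vanishing homotopy colimit -/

section Resolution

open DerivedCategory Pretriangulated

variable {S : Type u} [CommRing S]

lemma exists_shiftedFree_cover (Z : D S) (n : ℤ)
    [Module.Finite S ((homologyFunctor (ModuleCat.{u} S) n).obj Z)] :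
    ∃ (r : ℕ) (f : shiftedFree S n r ⟶ Z), Epi ((homologyFunctor _ n).map f) := by
  obtain ⟨r, h, hspan⟩ := Module.Finite.exists_fin (R := S)
    (M := (homologyFunctor (ModuleCat.{u} S) n).obj Z)
  choose f y hy using fun i => exists_map_of_homology n (h i)
  refine ⟨r, biproduct.desc f, (ModuleCat.epi_iff_range_eq_top _).2 ?_⟩
  rw [eq_top_iff, ← hspan, Submodule.span_le]
  rintro _ ⟨i, rfl⟩
  let ι : (singleFunctor (ModuleCat.{u} S) n).obj (ModuleCat.of S S) ⟶ shiftedFree S n r :=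
    biproduct.ι (fun _ : Fin r => (singleFunctor (ModuleCat.{u} S) n).obj (ModuleCat.of S S)) i
  have hι : ι ≫ biproduct.desc f = f i := biproduct.ι_desc _ _
  refine ⟨(homologyFunctor (ModuleCat.{u} S) n).map ι (y i), ?_⟩
  change (homologyFunctor (ModuleCat.{u} S) n).map (biproduct.desc f)
    ((homologyFunctor (ModuleCat.{u} S) n).map ι (y i)) = _
  rw [← ConcreteCategory.comp_apply, ← CategoryTheory.Functor.map_comp, hι, hy]

/-- Killing the top cohomology by a finite free module. -/
lemma exists_shiftedFree_triangle [IsNoetherianRing S] (Z : D S) (n : ℤ) [Z.IsLE n]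
    (hZ : HasFiniteHomology Z) :
    ∃ (r : ℕ) (Z' : D S) (f : shiftedFree S n r ⟶ Z) (z : Z ⟶ Z') (δ : Z' ⟶ _),
      Triangle.mk f z δ ∈ distTriang (D S) ∧ Z'.IsLE (n - 1) ∧ HasFiniteHomology Z' := by
  have := hZ n
  obtain ⟨r, f, hf⟩ := exists_shiftedFree_cover Z n
  obtain ⟨Z', z, δ, hT⟩ := distinguished_cocone_triangle f
  refine ⟨r, Z', f, z, δ, hT, ?_, ?_⟩
  · rw [isLE_iff]
    intro i hi
    have h3 := HomologySequence.exact₃ _ hT i (i + 1)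
    have h4 : IsZero ((homologyFunctor (ModuleCat.{u} S) (i + 1)).obj (shiftedFree S n r)) :=
      isZero_of_isLE _ n (i + 1) (by lia)
    -- In degree `n` the cohomology of the cone vanishes because the free cover is surjective there;
    -- above `n` because `Z` has none.
    refine h3.isZero_of_both_zeros ?_ (h4.eq_of_tgt _ _)
    rcases eq_or_lt_of_le (show n ≤ i by lia) with rfl | hi'
    · exact (HomologySequence.epi_homologyMap_mor₁_iff _ hT n).1 hf
    · have h5 : IsZero ((homologyFunctor (ModuleCat.{u} S) i).obj Z) := isZero_of_isLE _ n i hi'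
      exact h5.eq_of_src _ _
  · exact HasFiniteHomology.ext_of_isTriangulatedClosed₃ _ hT
      (prop_shiftedFree (hasFiniteHomology_singleFunctor _ _) r) hZ

/-- A free resolution, written as a sequence of objects which are more and more connected. -/
theorem exists_resolution [IsNoetherianRing S] (M : D S) [M.IsLE 0] (hM : HasFiniteHomology M) :
    ∃ (Z : ℕ → D S) (z : ∀ n, Z n ⟶ Z (n + 1)), Z 0 = M ∧ (∀ n : ℕ, (Z n).IsLE (-n)) ∧
      ∀ n : ℕ, ∃ (r : ℕ) (f : shiftedFree S (-n) r ⟶ Z n) (δ : Z (n + 1) ⟶ _),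
        Triangle.mk f (z n) δ ∈ distTriang (D S) := by
  let stage (n : ℕ) := {Z : D S // Z.IsLE (-(n : ℤ)) ∧ HasFiniteHomology Z}
  have step (n : ℕ) (Z : stage n) : ∃ (Z' : stage (n + 1)) (z : Z.1 ⟶ Z'.1) (r : ℕ)
      (f : shiftedFree S (-n) r ⟶ Z.1) (δ : Z'.1 ⟶ _), Triangle.mk f z δ ∈ distTriang (D S) := by
    have := Z.2.1
    obtain ⟨r, Z', f, z, δ, hT, h1, h2⟩ := exists_shiftedFree_triangle Z.1 (-n) Z.2.2
    have : -((n + 1 : ℕ) : ℤ) = -(n : ℤ) - 1 := by push_cast; ring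
    exact ⟨⟨Z', this ▸ h1, h2⟩, z, r, f, δ, hT⟩
  choose next z h using step
  let Z (n : ℕ) : stage n :=
    Nat.rec (motive := stage) ⟨M, by simpa, hM⟩ (fun n Z => next n Z) n
  exact ⟨fun n => (Z n).1, fun n => z n (Z n), rfl, fun n => (Z n).2.1, fun n => h n (Z n)⟩

instance : HasCoproductsOfShape ℕ (D S) := hasCoproducts_nat.{u}

lemma homologyFunctor_sigma_nat_hom_ext (Y : ℕ → D S) (n : ℤ) {M : ModuleCat.{u} S}
    {f g : (homologyFunctor _ n).obj (∐ Y) ⟶ M}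
    (h : ∀ j, (homologyFunctor _ n).map (Sigma.ι Y j) ≫ f =
      (homologyFunctor _ n).map (Sigma.ι Y j) ≫ g) : f = g := by
  let Y' : ULift.{u} ℕ → D S := fun j => Y j.down
  let a : ∐ Y' ⟶ ∐ Y := Limits.Sigma.desc fun j => Sigma.ι Y j.down
  let b : ∐ Y ⟶ ∐ Y' := Limits.Sigma.desc fun j => Sigma.ι Y' ⟨j⟩
  have hba : b ≫ a = 𝟙 _ := Sigma.hom_ext _ _ fun j => by simp [a, b]
  have : Epi ((homologyFunctor (ModuleCat.{u} S) n).map a) :=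
    @epi_of_epi_fac _ _ _ _ _ _ _ _ inferInstance (by rw [← Functor.map_comp, hba])
  rw [← cancel_epi ((homologyFunctor (ModuleCat.{u} S) n).map a)]
  refine homologyFunctor_sigma_hom_ext Y' n fun j => ?_
  rw [← Functor.map_comp_assoc, ← Functor.map_comp_assoc, Sigma.ι_desc, h]

lemma exists_ι_comp_pow {C : Type u₁} [Category.{v₁} C] [Preadditive C] {Z : ℕ → C}
    (z : ∀ n, Z n ⟶ Z (n + 1))
    [HasCoproduct Z] (φ : End (∐ Z)) (hφ : ∀ n, Sigma.ι Z n ≫ φ = z n ≫ Sigma.ι Z (n + 1))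
    (m n : ℕ) : ∃ g : Z n ⟶ Z (n + m), Sigma.ι Z n ≫ (φ ^ m : End (∐ Z)) = g ≫ Sigma.ι Z (n + m)
        := by
  induction m with
  | zero => exact ⟨𝟙 _, by simp [End.one_def]⟩
  | succ m ih =>
    obtain ⟨g, hg⟩ := ih
    refine ⟨g ≫ z _, ?_⟩
    rw [pow_succ', End.mul_def, reassoc_of% hg, hφ, Category.assoc]
    rfl

/-- The homotopy colimit of a sequence of more and more connected objects vanishes. -/
theorem isIso_telescope {Z : ℕ → D S} (z : ∀ n, Z n ⟶ Z (n + 1))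
    (hZ : ∀ n : ℕ, (Z n).IsLE (-n)) : IsIso (telescope z) := by
  rw [DerivedCategory.isIso_iff]
  intro k
  let φ : End (∐ Z) := Limits.Sigma.desc fun n => z n ≫ Sigma.ι Z (n + 1)
  let H := homologyFunctor (ModuleCat.{u} S) k
  let a : End (H.obj (∐ Z)) := H.map φ
  have ha : IsNilpotent a := by
    -- Each application of `φ` moves one step along the sequence. After `|k| + 1` steps from any `Z
    -- n` the target lives in degrees `≤ -(n + |k| + 1) < k`, so one exponent kills all summands and
    -- `1 - a` is invertible.
    refine ⟨k.natAbs + 1, homologyFunctor_sigma_nat_hom_ext Z k fun n => ?_⟩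
    obtain ⟨g, hg⟩ := exists_ι_comp_pow z φ (fun n => Sigma.ι_desc _ _) (k.natAbs + 1) n
    have h1 : a ^ (k.natAbs + 1) = H.map (φ ^ (k.natAbs + 1)) :=
      (map_pow (Functor.mapEnd (∐ Z) H) φ _).symm
    have h2 : IsZero (H.obj (Z (n + (k.natAbs + 1)))) := by
      have := hZ (n + (k.natAbs + 1))
      exact isZero_of_isLE _ (-((n + (k.natAbs + 1) : ℕ) : ℤ)) k (by
        have := neg_abs_le k
        push_cast
        lia)
    rw [h1, ← Functor.map_comp, hg, Functor.map_comp, h2.eq_of_tgt (H.map g) 0, zero_comp]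
    exact comp_zero.symm
  have h := (ha.isUnit_one_sub)
  rw [isUnit_iff_isIso] at h
  have h3 : H.map (telescope z) = (1 - a : End _) := by
    rw [telescope, CategoryTheory.Functor.map_sub, CategoryTheory.Functor.map_id]
    rfl
  exact h3 ▸ h

end Resolution

/-! ### Binary biproducts -/

section Biproduct

lemma prop_biprod_of_closed₂ {C : Type u} [Category.{v} C] [HasZeroObject C] [HasShift C ℤ]
    [Preadditive C] [∀ n : ℤ, (shiftFunctor C n).Additive] [Pretriangulated C]
    {P : ObjectProperty C} [P.IsTriangulatedClosed₂] [P.IsClosedUnderIsomorphisms] {X₁ X₂ : C}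
    [HasBinaryBiproduct X₁ X₂] (h₁ : P X₁) (h₂ : P X₂) : P (X₁ ⊞ X₂) :=
  P.ext_of_isTriangulatedClosed₂ _ (Pretriangulated.binaryBiproductTriangle_distinguished X₁ X₂)
    h₁ h₂

lemma isZero_obj_biprod {C₁ C₂ : Type*} [Category C₁] [Category C₂] [Preadditive C₁]
    [Preadditive C₂] (F : C₁ ⥤ C₂) [F.Additive] {X Y : C₁} [HasBinaryBiproduct X Y]
    (hX : IsZero (F.obj X)) (hY : IsZero (F.obj Y)) : IsZero (F.obj (X ⊞ Y)) := by
  rw [IsZero.iff_id_eq_zero, ← F.map_id, ← biprod.total, Functor.map_add, Functor.map_comp,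
    Functor.map_comp, hX.eq_of_src (F.map biprod.inl) 0, hY.eq_of_src (F.map biprod.inr) 0]
  simp

end Biproduct

/-! ### Proxy smallness of the object -/

section ProxySmallness

open DerivedCategory Pretriangulated

section

variable {S : Type u} [CommRing S]

lemma prop_singleFunctor {Q : ObjectProperty (D S)} [Q.IsTriangulated]
    [Q.IsClosedUnderIsomorphisms] {M : ModuleCat.{u} S} (h : Q (inDegreeZero S M)) (n : ℤ) :
    Q ((singleFunctor _ n).obj M) :=
  Q.prop_of_iso (((singleFunctors _).shiftIso (-n) n 0 (by simp)).app M) (Q.le_shift (-n) _ h)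

/-- Connective complexes with finitely generated cohomology belong to every localizing subcategory
that contains the ring. -/
theorem prop_of_hasFiniteHomology [IsNoetherianRing S] {Q : ObjectProperty (D S)}
    (hQ : IsLocalizing.{u} Q) (h : Q (ringObj S)) (M : D S) [M.IsLE 0]
    (hM : HasFiniteHomology M) : Q M := by
  have := hQ.isoClosed
  have := hQ.triangulated
  have := hQ.coproducts.nat
  obtain ⟨Z, z, rfl, hZ, hz⟩ := exists_resolution M hM
  have := isIso_telescope z hZ
  refine prop_zero_of_isIso_telescope z fun n => ?_
  -- The fibre of `z n` is a shifted finite free module, so `z n` is an isomorphism modulo `Q`.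
  obtain ⟨r, f, δ, hT⟩ := hz n
  exact ObjectProperty.trW.mk' _ hT (prop_shiftedFree (prop_singleFunctor h _) r)

end

variable (R : Type u) [CommRing R] (Y : Type u) [AddCommGroup Y] [Module R Y]

lemma finite_trivSqZeroExt [Module.Finite R Y] : Module.Finite R (TrivSqZeroExt R Y) :=
  inferInstanceAs (Module.Finite R (R × Y))

variable [Module Rᵐᵒᵖ Y] [IsCentralScalar R Y]

lemma isNoetherianRing_trivSqZeroExt [IsNoetherianRing R] [Module.Finite R Y] :
    IsNoetherianRing (TrivSqZeroExt R Y) :=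
  have := finite_trivSqZeroExt R Y
  isNoetherian_of_tower R (isNoetherian_of_isNoetherianRing_of_finite R _)

instance : Module.Finite (TrivSqZeroExt R Y) (baseModule R Y) := by
  let f : TrivSqZeroExt R Y →ₗ[TrivSqZeroExt R Y] baseModule R Y :=
    LinearMap.toSpanSingleton _ _ (show R from 1)
  exact Module.Finite.of_surjective f fun r => ⟨TrivSqZeroExt.inl r, mul_one (M := R) r⟩

lemma hasFiniteHomology_trivExtObj [IsNoetherianRing (TrivSqZeroExt R Y)] :
    HasFiniteHomology (trivExtObj R Y) :=
  prop_biprod_of_closed₂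
    (HasFiniteHomology.le_shift (1 : ℤ) _ (hasFiniteHomology_singleFunctor _ _))
    (hasFiniteHomology_singleFunctor _ _)

lemma isZero_homology_trivExtObj (n : ℤ) (hn : 1 < |n|) :
    IsZero ((homologyFunctor (ModuleCat.{u} (TrivSqZeroExt R Y)) n).obj (trivExtObj R Y)) := by
  let H := homologyFunctor (ModuleCat.{u} (TrivSqZeroExt R Y)) n
  have h1 : IsZero (H.obj ((ringObj (TrivSqZeroExt R Y))⟦(1 : ℤ)⟧)) := by
    have : ((ringObj (TrivSqZeroExt R Y))⟦(1 : ℤ)⟧).IsLE (-1) :=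
      TStructure.t.isLE_shift _ 0 1 (-1)
    have : ((ringObj (TrivSqZeroExt R Y))⟦(1 : ℤ)⟧).IsGE (-1) :=
      TStructure.t.isGE_shift _ 0 1 (-1)
    rcases lt_abs.1 hn with h | h
    · exact isZero_of_isLE _ (-1) n (by lia)
    · exact isZero_of_isGE _ (-1) n (by lia)
  have h2 : IsZero (H.obj (inDegreeZero _ (baseModule R Y))) := by
    rcases lt_abs.1 hn with h | h
    · exact isZero_of_isLE _ 0 n (by lia)
    · exact isZero_of_isGE _ 0 n (by lia)
  exact isZero_obj_biprod H h1 h2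

theorem isBoundedCoherent_trivExtObj [IsNoetherianRing (TrivSqZeroExt R Y)] :
    IsBoundedCoherent (trivExtObj R Y) :=
  ⟨hasFiniteHomology_trivExtObj R Y, 1, fun n hn => isZero_homology_trivExtObj R Y n hn⟩

/-- The free summand of `(R ⋉ Y)[1] ⊕ R`. -/
noncomputable def retractRing : Retract ((ringObj (TrivSqZeroExt R Y))⟦(1 : ℤ)⟧) (trivExtObj R Y) :=
  ⟨biprod.inl, biprod.fst, biprod.inl_fst⟩

/-- The summand `R` of `(R ⋉ Y)[1] ⊕ R`. -/
noncomputable def retractBase : Retract (inDegreeZero _ (baseModule R Y)) (trivExtObj R Y) :=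
  ⟨biprod.inr, biprod.snd, biprod.inr_snd⟩

/-- The ring is obtained from the summand `S[1]` by the shift `[-1]`, a move open to thick but not
to suspended subcategories. It is compact, and it generates `R` by a free resolution. -/
theorem isProxySmallObj_trivExtObj [IsNoetherianRing (TrivSqZeroExt R Y)] :
    IsProxySmallObj.{u} (trivExtObj R Y) := by
  refine le_antisymm (fun X hX Q hQ hle => hX Q hQ ?_) (localizing_thick_inf_le _ _)
  have := hQ.isoClosed
  have := hQ.triangulated
  have hring : Q (ringObj (TrivSqZeroExt R Y)) := by
    refine hle _ ⟨fun Q' hQ' hle' => ?_, isCompact_ringObj⟩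
    have := hQ'.triangulated
    have := hQ'.retracts
    have h1 : Q' ((ringObj (TrivSqZeroExt R Y))⟦(1 : ℤ)⟧) :=
      Q'.prop_of_retract (retractRing R Y) (hle' _ ((ObjectProperty.singleton_iff _ _).2 rfl))
    exact Q'.prop_of_iso (shiftShiftNeg _ (1 : ℤ)) (Q'.le_shift (-1 : ℤ) _ h1)
  rw [ObjectProperty.singleton_le_iff]
  exact prop_biprod_of_closed₂ (Q.le_shift (1 : ℤ) _ hring)
    (prop_of_hasFiniteHomology hQ hring _ (hasFiniteHomology_singleFunctor _ _))

end ProxySmallness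

/-! ### Maps out of compact connective objects -/

section CompactMaps

open DerivedCategory Pretriangulated

variable {R S : Type u} [CommRing R] [CommRing S]

lemma eq_zero_of_projective_of_isLE (F : ModuleCat.{u} S) [Projective F] (a b : ℤ) (hab : b < a)
    {Z : D S} [Z.IsLE b] (f : (singleFunctor _ a).obj F ⟶ Z) : f = 0 := by
  obtain ⟨K, _, ⟨e⟩⟩ := exists_iso_Q_obj_of_isLE Z b
  let g : Q.obj ((HomologicalComplex.single _ (ComplexShape.up ℤ) a).obj F) ⟶ Q.obj K := f ≫ e.hom
  obtain ⟨φ, hφ⟩ := exists_eq_Q_map_of_projective F a g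
  have h0 : φ = 0 := HomologicalComplex.from_single_hom_ext
    ((CochainComplex.isZero_of_isStrictlyLE K b a hab).eq_of_tgt _ _)
  rw [← cancel_mono e.hom, Limits.zero_comp]
  change g = 0
  rw [hφ, h0, Functor.map_zero]

lemma fromZero_succ' {C : Type u₁} [Category.{v₁} C] {Z : ℕ → C} (z : ∀ n, Z n ⟶ Z (n + 1))
    (n : ℕ) : fromZero z (n + 1) = z 0 ≫ fromZero (Z := fun n => Z (n + 1)) (fun n => z (n + 1))
        n := by
  induction n with
  | zero => simp [fromZero]
  | succ n ih => rw [fromZero, ih, Category.assoc]; rfl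

/-- Reduces vanishing on a finite free module to its summands, even though `m` starts in a different
category from `e`. -/
lemma comp_biproduct_eq_zero {C : Type*} [Category C] {C' : Type*} [Category C'] [Preadditive C]
    [Preadditive C'] (U : C ⥤ C') [U.Additive] {r : ℕ} (X : Fin r → C) [HasBiproduct X] {A : C'}
    {B : C} (m : A ⟶ U.obj (⨁ X)) (e : ⨁ X ⟶ B)
    (h : ∀ i (a : A ⟶ U.obj (X i)), a ≫ U.map (biproduct.ι X i ≫ e) = 0) : m ≫ U.map e = 0 := by
  have : e = ∑ i, biproduct.π X i ≫ biproduct.ι X i ≫ e := by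
    simp_rw [← Category.assoc]
    rw [← Preadditive.sum_comp, biproduct.total, Category.id_comp]
  rw [this, Functor.map_sum, Preadditive.comp_sum]
  refine Finset.sum_eq_zero fun i _ => ?_
  rw [U.map_comp, ← Category.assoc, h]

variable (U : D S ⥤ D R) [U.CommShift ℤ] [U.IsTriangulated] [U.Additive]

/-- If `X` has no maps to the shifts of the ring in degrees `≤ -2`, then the maps from `X` to a
term of a resolution are detected further along the resolution. -/
lemma comp_eq_zero_of_comp_fromZero_eq_zero {X : D R}
    (hX : ∀ n : ℕ, 2 ≤ n → ∀ g : X ⟶ U.obj ((singleFunctor _ (-n : ℤ)).obj (ModuleCat.of S S)), g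
        = 0)
    {Z : ℕ → D S} (z : ∀ n, Z n ⟶ Z (n + 1))
    (hz : ∀ n : ℕ, ∃ (r : ℕ) (f : shiftedFree S (-n) r ⟶ Z n) (δ : Z (n + 1) ⟶ _),
        Triangle.mk f (z n) δ ∈ distTriang (D S))
    (m : X ⟶ U.obj (Z 1)) (k : ℕ)
    (h : m ≫ U.map (fromZero (Z := fun n => Z (n + 1)) (fun n => z (n + 1)) (k + 1)) = 0) :
    m ≫ U.map (z 1) = 0 := by
  induction k with
  | zero => simpa [fromZero] using h
  | succ k ih =>
    apply ih
    -- A map that dies in the next term lifts to the free module over `Z (k + 2)`, a power of the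
    -- ring in degree `-(k + 2)`, to which `X` has no maps.
    obtain ⟨r, f, δ, hT⟩ := hz (k + 2)
    rw [fromZero, Functor.map_comp, ← Category.assoc] at h
    obtain ⟨g, hg⟩ : ∃ g : X ⟶ U.obj (shiftedFree S (-(k + 2 : ℕ)) r), _ = g ≫ U.map f :=
      Triangle.coyoneda_exact₂ _ (U.map_distinguished _ hT) _ h
    rw [hg]
    refine comp_biproduct_eq_zero U _ g f fun i a => ?_
    rw [hX (k + 2) (by lia) a, zero_comp]

/-- Let `X` be an object of `D(R)` with no maps to the image of `Z`, where `Z` is compact and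
connective. A map from `Z` to a quotient `V` of the ring by the annihilator of the maps from `X` to
(the image of) the ring vanishes. -/
theorem eq_zero_of_isCompact [IsNoetherianRing S] {X : D R} {V : D S} [V.IsGE 0]
    (φ : ringObj S ⟶ V) (hφ : ∀ f : ringObj S ⟶ V, ∃ g : ringObj S ⟶ ringObj S, f = g ≫ φ)
    (hφ' : ∀ s : ringObj S ⟶ ringObj S,
      s ≫ φ = 0 ↔ ∀ x : X ⟶ U.obj (ringObj S), x ≫ U.map s = 0)
    (hX : ∀ n : ℕ, 2 ≤ n → ∀ g : X⟦(1 : ℤ)⟧ ⟶ U.obj ((singleFunctor _ (-n : ℤ)).obj (ModuleCat.of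
        S S)),
      g = 0)
    {Z : D S} [Z.IsLE 0] (hZ : HasFiniteHomology Z) (hc : IsCompact.{u} Z)
    (hXZ : ∀ g : X ⟶ U.obj Z, g = 0) (f : Z ⟶ V) : f = 0 := by
  obtain ⟨Z, z, rfl, hLE, hz⟩ := exists_resolution Z hZ
  have := isIso_telescope z hLE
  obtain ⟨k, hk, hk0⟩ := exists_fromZero_eq_zero z hc 2
  obtain ⟨k, rfl⟩ := Nat.exists_eq_add_of_le' hk
  rw [fromZero_succ'] at hk0
  have hz0 := hz 0
  have hz1 := hz 1
  rw [show (-((0 : ℕ) : ℤ)) = 0 from rfl] at hz0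
  rw [show (-((1 : ℕ) : ℤ)) = -1 from rfl] at hz1
  obtain ⟨r₀, f₀, δ₀, hT₀⟩ := hz0
  obtain ⟨r₁, f₁, δ₁, hT₁⟩ := hz1
  -- Since the composite `Z 0 ⟶ Z (k + 2)` is zero, its tail `Z 1 ⟶ Z (k + 2)` factors through `δ₀`.
  obtain ⟨q, hq⟩ : ∃ q : (shiftedFree S 0 r₀)⟦(1 : ℤ)⟧ ⟶ _, _ = δ₀ ≫ q :=
    Triangle.yoneda_exact₃ _ hT₀ _ hk0
  let F (_ : Fin r₀) : D S := ringObj S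
  choose g hg using fun i => hφ (biproduct.ι F i ≫ f₀ ≫ f)
  let g' : shiftedFree S 0 r₀ ⟶ ringObj S := biproduct.desc g
  have hg' : g' ≫ φ = f₀ ≫ f := biproduct.hom_ext' _ _ fun i =>
    (biproduct.ι_desc_assoc _ _ _).trans (hg i).symm
  have hδ : δ₀ ≫ f₀⟦(1 : ℤ)⟧' = 0 := comp_distTriang_mor_zero₃₁ _ hT₀
  -- The entries of `e` annihilate the maps from `X` to the ring: followed by `φ[1]`, `e` contains
  -- `δ₀ ≫ f₀[1] = 0`.
  let e : shiftedFree S (-1) r₁ ⟶ (ringObj S)⟦(1 : ℤ)⟧ := f₁ ≫ δ₀ ≫ g'⟦(1 : ℤ)⟧'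
  have he : e ≫ φ⟦(1 : ℤ)⟧' = 0 := by
    rw [Category.assoc, Category.assoc, ← Functor.map_comp, hg', Functor.map_comp,
      reassoc_of% hδ, zero_comp, comp_zero]
  have hshift {s : ringObj S ⟶ ringObj S} (hs : s ≫ φ = 0)
      (a : X⟦(1 : ℤ)⟧ ⟶ U.obj ((ringObj S)⟦(1 : ℤ)⟧)) : a ≫ U.map (s⟦(1 : ℤ)⟧') = 0 := by
    obtain ⟨b, hb⟩ := (shiftFunctor (D R) (1 : ℤ)).map_surjective
      (a ≫ (U.commShiftIso (1 : ℤ)).hom.app _)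
    rw [← cancel_mono ((U.commShiftIso (1 : ℤ)).hom.app _), Category.assoc, zero_comp,
      U.commShiftIso_hom_naturality, ← Category.assoc, ← hb, ← Functor.map_comp,
      (hφ' s).1 hs b, Functor.map_zero]
  have hm' (m : X⟦(1 : ℤ)⟧ ⟶ U.obj (shiftedFree S (-1) r₁)) : m ≫ U.map e = 0 := by
    refine comp_biproduct_eq_zero U _ m e fun i a => ?_
    let ι : (ringObj S)⟦(1 : ℤ)⟧ ≅ (singleFunctor _ (-1)).obj (ModuleCat.of S S) :=
      ((singleFunctors (ModuleCat.{u} S)).shiftIso 1 (-1) 0 (by simp)).app _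
    let e' : (singleFunctor _ (-1)).obj (ModuleCat.of S S) ⟶ (ringObj S)⟦(1 : ℤ)⟧ :=
      biproduct.ι (fun _ : Fin r₁ => (singleFunctor _ (-1)).obj (ModuleCat.of S S)) i ≫ e
    obtain ⟨s, hs⟩ := (shiftFunctor (D S) (1 : ℤ)).map_surjective (ι.hom ≫ e')
    have hsφ : s ≫ φ = 0 := by
      apply (shiftFunctor (D S) (1 : ℤ)).map_injective
      rw [Functor.map_comp, hs, Functor.map_zero, Category.assoc, Category.assoc, he, comp_zero,
        comp_zero]
    have h1 := hshift hsφ (a ≫ U.map ι.inv)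
    rw [hs, Category.assoc, ← Functor.map_comp, Iso.inv_hom_id_assoc] at h1
    exact h1
  have h0 : f₀ ≫ f = 0 := by
    refine biproduct.hom_ext' _ _ fun i => ?_
    rw [comp_zero]
    let ι : ringObj S ⟶ shiftedFree S 0 r₀ := biproduct.ι F i
    change ι ≫ f₀ ≫ f = 0
    rw [← hg', ← Category.assoc, hφ']
    intro x
    -- The composite of `x` with the map to `Z 0` vanishes by `hXZ`, so the shifted class lifts
    -- along `δ₀`.
    obtain ⟨m, hm⟩ : ∃ m : X⟦(1 : ℤ)⟧ ⟶ U.obj (Z 1), (x ≫ U.map ι)⟦(1 : ℤ)⟧' =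
        m ≫ U.map δ₀ ≫ (U.commShiftIso (1 : ℤ)).hom.app _ := by
      refine Triangle.coyoneda_exact₁ _ (U.map_distinguished _ hT₀) _ ?_
      change _ ≫ (U.map f₀)⟦(1 : ℤ)⟧' = 0
      rw [← Functor.map_comp, Category.assoc, ← Functor.map_comp, hXZ (x ≫ _), Functor.map_zero]
    have hm1 : m ≫ U.map δ₀ = x⟦(1 : ℤ)⟧' ≫ (U.commShiftIso (1 : ℤ)).inv.app _ ≫
        U.map (ι⟦(1 : ℤ)⟧') := by
      rw [← cancel_mono ((U.commShiftIso (1 : ℤ)).hom.app _), Category.assoc, ← hm,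
        Functor.map_comp, Category.assoc, Category.assoc, U.commShiftIso_hom_naturality,
        Iso.inv_hom_id_app_assoc]
    have hm2 : m ≫ U.map (z 1) = 0 := by
      refine comp_eq_zero_of_comp_fromZero_eq_zero U hX z hz m k ?_
      -- The source is a projective module in degree `-1` and the target lives in degrees `≤ -2`;
      -- this is why compactness was applied with the bound `2`.
      have hι : ι⟦(1 : ℤ)⟧' ≫ q = 0 := by
        have : (Z (k + 1 + 1)).IsLE (-2) :=
          have := hLE (k + 1 + 1)
          TStructure.t.isLE_of_le _ (-((k + 1 + 1 : ℕ) : ℤ)) (-2) (by push_cast; lia)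
        let j : (ringObj S)⟦(1 : ℤ)⟧ ≅ (singleFunctor _ (-1)).obj (ModuleCat.of S S) :=
          ((singleFunctors (ModuleCat.{u} S)).shiftIso 1 (-1) 0 (by simp)).app _
        rw [← cancel_epi j.inv, comp_zero]
        exact eq_zero_of_projective_of_isLE _ (-1) (-2) (by lia) _
      rw [hq, Functor.map_comp, reassoc_of% hm1, ← Functor.map_comp, hι, Functor.map_zero,
        comp_zero, comp_zero]
    obtain ⟨m', hm'm⟩ : ∃ m' : X⟦(1 : ℤ)⟧ ⟶ U.obj (shiftedFree S (-1) r₁), m = m' ≫ U.map f₁ :=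
      Triangle.coyoneda_exact₂ _ (U.map_distinguished _ hT₁) _ hm2
    apply (shiftFunctor (D R) (1 : ℤ)).map_injective
    rw [U.map_comp, ← Category.assoc, Functor.map_comp, hm, Functor.map_zero, Category.assoc,
      Category.assoc, ← U.commShiftIso_hom_naturality, ← Functor.map_comp_assoc, hm'm,
      Category.assoc, ← Functor.map_comp_assoc, reassoc_of% hm' m', zero_comp]
  -- What remains is a map from degrees `≤ -1` to degrees `≥ 0`.
  obtain ⟨p, rfl⟩ : ∃ p : Z 1 ⟶ V, f = z 0 ≫ p := Triangle.yoneda_exact₂ _ hT₀ f h0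
  have := hLE 1
  rw [TStructure.t.zero p (-((1 : ℕ) : ℤ)) 0 (by simp), comp_zero]

end CompactMaps

/-! ### Failure of `t`-proxy smallness -/

section NotTProxySmall

open DerivedCategory Pretriangulated

section

variable {R S : Type u} [CommRing R] [CommRing S]

lemma eq_zero_of_subsingleton_ext [HasExt.{w} (ModuleCat.{u} R)] (X N : ModuleCat.{u} R) (j : ℕ)
    [Subsingleton (Abelian.Ext X N j)] (a b : ℤ) (h : b + j = a)
    (g : (singleFunctor _ a).obj X ⟶ (singleFunctor _ b).obj N) : g = 0 := by
  let i₁ := ((singleFunctors (ModuleCat.{u} R)).shiftIso a 0 a (by simp)).app X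
  let i₂ := ((singleFunctors (ModuleCat.{u} R)).shiftIso a (-j) b (by lia)).app N
  let i₃ := ((singleFunctors (ModuleCat.{u} R)).shiftIso j (-j) 0 (by lia)).app N
  apply (shiftFunctor (D R) a).map_injective
  rw [Functor.map_zero, ← cancel_epi i₁.inv, ← cancel_mono (i₂.hom ≫ i₃.inv), comp_zero, zero_comp]
  have := (Abelian.Ext.homEquiv (X := X) (Y := N) (n := j)).symm.subsingleton
  exact Subsingleton.elim (α := ShiftedHom _ _ (j : ℤ)) _ _

lemma subsingleton_ext_of_eq_zero [HasExt.{w} (ModuleCat.{u} R)] (X N : ModuleCat.{u} R) (j : ℕ)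
    (h : ∀ g : (singleFunctor _ (j : ℤ)).obj X ⟶ (singleFunctor _ 0).obj N, g = 0) :
    Subsingleton (Abelian.Ext X N j) := by
  refine (Abelian.Ext.homEquiv (X := X) (Y := N) (n := j)).subsingleton_congr.2 ⟨fun f f' => ?_⟩
  let i₁ := ((singleFunctors (ModuleCat.{u} R)).shiftIso j 0 j (by simp)).app X
  suffices ∀ f : (singleFunctor _ 0).obj X ⟶ ((singleFunctor _ 0).obj N)⟦(j : ℤ)⟧, f = 0 from
    (this f).trans (this f').symm
  intro f
  obtain ⟨g, hg⟩ := (shiftFunctor (D R) (j : ℤ)).map_surjective (i₁.hom ≫ f)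
  rw [← cancel_epi i₁.hom, ← hg, h g, Functor.map_zero, comp_zero]

/-- The objects of `D(S)` without maps to the nonpositive shifts of the module `V`. -/
def leftOrth (V : ModuleCat.{u} S) : ObjectProperty (D S) := fun Z =>
  ∀ (i : ℕ) (g : Z ⟶ (singleFunctor _ (i : ℤ)).obj V), g = 0

instance (V : ModuleCat.{u} S) : (leftOrth V).IsClosedUnderIsomorphisms :=
  ⟨fun e h i g => by rw [← cancel_epi e.hom, h i (e.hom ≫ g), comp_zero]⟩

/-- Closure under `[1]` holds because the set of targets `V[-i]`, `i ≥ 0`, is stable under `[-1]`;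
the rest is exactness of `Hom` and the universal property of coproducts. -/
lemma isCocompletePreaisle_leftOrth (V : ModuleCat.{u} S) :
    IsCocompletePreaisle.{u} (leftOrth V) where
  isoClosed := inferInstance
  zero := ⟨_, isZero_zero _, fun i g => (isZero_zero _).eq_of_src _ _⟩
  shift := ⟨fun Z hZ i g => by
    let e := ((singleFunctors (ModuleCat.{u} S)).shiftIso 1 i (i + 1 : ℕ)
      (by push_cast; ring)).app V
    obtain ⟨b, hb⟩ := (shiftFunctor (D S) (1 : ℤ)).map_surjective (g ≫ e.inv)
    rw [← cancel_mono e.inv, ← hb, hZ (i + 1) b, Functor.map_zero, zero_comp]⟩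
  extensions := .mk' fun T hT h₁ h₃ i g => by
    obtain ⟨p, hp⟩ := Triangle.yoneda_exact₂ _ hT g (h₁ i _)
    rw [hp, h₃ i p, comp_zero]
  coproducts J := ⟨fun Z ⟨h⟩ i g => h.isColimit.hom_ext fun j => by
    rw [h.prop_diag_obj j i (_ ≫ g), comp_zero]⟩

variable (U : D S ⥤ D R) [U.CommShift ℤ] [U.IsTriangulated]

/-- The objects of `D(S)` whose images under `U` receive no maps of positive degree from `X`. -/
def noPositiveMaps (X : ModuleCat.{u} R) : ObjectProperty (D S) := fun Z =>
  ∀ (i : ℕ) (g : (singleFunctor _ (i + 1 : ℤ)).obj X ⟶ U.obj Z), g = 0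

instance (X : ModuleCat.{u} R) : (noPositiveMaps U X).IsClosedUnderIsomorphisms :=
  ⟨fun e h i g => by rw [← cancel_mono (U.mapIso e.symm).hom, h i (g ≫ _), zero_comp]⟩

/-- The condition is that `Ext` from `X` vanishes in positive degrees, and `[1]` only lowers
degrees. Coproducts play no role: this class tests only the suspended subcategory generated by `E`.
-/
lemma isSuspended_noPositiveMaps (X : ModuleCat.{u} R) : IsSuspended (noPositiveMaps U X) where
  isoClosed := inferInstance
  zero := ⟨_, isZero_zero _, fun i g => (U.map_isZero (isZero_zero _)).eq_of_tgt _ _⟩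
  shift := ⟨fun Z hZ i g => by
    let e := ((singleFunctors (ModuleCat.{u} R)).shiftIso 1 (i + 1) ((i + 1 : ℕ) + 1)
      (by push_cast; ring)).app X
    obtain ⟨b, hb⟩ := (shiftFunctor (D R) (1 : ℤ)).map_surjective
      (e.hom ≫ g ≫ (U.commShiftIso (1 : ℤ)).hom.app Z)
    rw [← cancel_epi e.hom, ← cancel_mono ((U.commShiftIso (1 : ℤ)).hom.app Z), Category.assoc,
      ← hb, hZ (i + 1) b, Functor.map_zero, comp_zero, zero_comp]⟩
  extensions := .mk' fun T hT h₁ h₃ i g => by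
    obtain ⟨p, hp⟩ : ∃ p : _ ⟶ U.obj T.obj₁, g = p ≫ U.map T.mor₁ :=
      Triangle.coyoneda_exact₂ _ (U.map_distinguished _ hT) g (h₃ i _)
    rw [hp, h₁ i p, zero_comp]
  retracts := ⟨fun h hY i g => by
    rw [← Category.comp_id g, ← U.map_id, ← h.retract, U.map_comp, ← Category.assoc, hY i (g ≫ _),
      zero_comp]⟩

variable (S) in
/-- The connective objects with finitely generated cohomology. -/
def connective : ObjectProperty (D S) := fun Z => Z.IsLE 0 ∧ HasFiniteHomology Z

instance : (connective S).IsClosedUnderIsomorphisms :=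
  ⟨fun e ⟨_, h⟩ => ⟨TStructure.t.isLE_of_iso e 0, HasFiniteHomology.prop_of_iso e h⟩⟩

/-- Ensures that the compact objects to be tested have resolutions by finite free modules. -/
lemma isSuspended_connective [IsNoetherianRing S] : IsSuspended (connective S) where
  isoClosed := inferInstance
  zero := ⟨_, isZero_zero _, by
    refine ⟨(isLE_iff _ _).2 ?_, HasFiniteHomology.prop_zero⟩
    exact fun i _ => Functor.map_isZero _ (isZero_zero _)⟩
  shift := ⟨fun Z ⟨_, h⟩ => ⟨have := TStructure.t.isLE_shift Z 0 1 (-1)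
    TStructure.t.isLE_of_le _ (-1) 0, HasFiniteHomology.le_shift (1 : ℤ) _ h⟩⟩
  extensions := .mk' fun T hT ⟨h₁, h₁'⟩ ⟨h₃, h₃'⟩ => by
    rw [isLE_iff] at h₁ h₃
    exact ⟨(isLE_iff _ _).2 fun i hi => (HomologySequence.exact₂ T hT i).isZero_of_both_zeros
      ((h₁ i hi).eq_of_src _ _) ((h₃ i hi).eq_of_tgt _ _),
      HasFiniteHomology.ext_of_isTriangulatedClosed₂ T hT h₁' h₃'⟩
  retracts := ⟨fun h ⟨h₁, h₂⟩ => by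
    rw [isLE_iff] at h₁
    refine ⟨(isLE_iff _ _).2 fun i hi => ?_, fun n => ?_⟩
    · exact IsZero.of_mono (h.map (homologyFunctor (ModuleCat.{u} S) i)).i (h₁ i hi)
    · have := h₂ n
      let r := h.map (homologyFunctor (ModuleCat.{u} S) n)
      exact Module.Finite.of_surjective r.r.hom
        ((ModuleCat.epi_iff_surjective _).1 inferInstance)⟩

end

variable (R : Type u) [CommRing R] (Y : Type u) [AddCommGroup Y] [Module R Y]
  [Module Rᵐᵒᵖ Y] [IsCentralScalar R Y]

/-- Restriction of scalars along the inclusion of `R` into `R ⋉ Y`. -/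
noncomputable abbrev restriction : ModuleCat.{u} (TrivSqZeroExt R Y) ⥤ ModuleCat.{u} R :=
  ModuleCat.restrictScalars (TrivSqZeroExt.inlHom R Y)

noncomputable abbrev derivedRestriction : D (TrivSqZeroExt R Y) ⥤ D R :=
  (restriction R Y).mapDerivedCategory

/-- The trivial extension as a module over itself. -/
noncomputable abbrev selfModule : ModuleCat.{u} (TrivSqZeroExt R Y) :=
  ModuleCat.of (TrivSqZeroExt R Y) (TrivSqZeroExt R Y)

/-- The two summands of the trivial extension. -/
noncomputable def inlMap : ModuleCat.of R R ⟶ (restriction R Y).obj (selfModule R Y) :=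
  ModuleCat.ofHom (Y := (restriction R Y).obj (selfModule R Y))
  { toFun := fun r => (TrivSqZeroExt.inl r : TrivSqZeroExt R Y)
    map_add' := fun r s => TrivSqZeroExt.inl_add Y r s
    map_smul' := fun r s => TrivSqZeroExt.inl_mul Y r s }

noncomputable def inrMap : ModuleCat.of R Y ⟶ (restriction R Y).obj (selfModule R Y) :=
  ModuleCat.ofHom (Y := (restriction R Y).obj (selfModule R Y))
  { toFun := fun y => (TrivSqZeroExt.inr y : TrivSqZeroExt R Y)
    map_add' := fun r s => TrivSqZeroExt.inr_add R r s
    map_smul' := fun r s => (TrivSqZeroExt.inl_mul_inr r s).symm }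

noncomputable def fstMap : (restriction R Y).obj (selfModule R Y) ⟶ ModuleCat.of R R :=
  ModuleCat.ofHom (X := (restriction R Y).obj (selfModule R Y))
  { toFun := fun s : TrivSqZeroExt R Y => s.fst
    map_add' := fun _ _ => rfl
    map_smul' := fun _ _ => rfl }

noncomputable def sndMap : (restriction R Y).obj (selfModule R Y) ⟶ ModuleCat.of R Y :=
  ModuleCat.ofHom (X := (restriction R Y).obj (selfModule R Y))
  { toFun := fun s : TrivSqZeroExt R Y => s.snd
    map_add' := fun _ _ => rfl
    map_smul' := fun r (s : TrivSqZeroExt R Y) => by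
      change (TrivSqZeroExt.inl r * s).snd = r • s.snd
      simp }

lemma fst_inl_add_snd_inr : fstMap R Y ≫ inlMap R Y + sndMap R Y ≫ inrMap R Y = 𝟙 _ := by
  ext s
  exact TrivSqZeroExt.inl_fst_add_inr_snd_eq (R := R) (M := Y) s

lemma inrMap_sndMap : inrMap R Y ≫ sndMap R Y = 𝟙 _ := by
  ext s
  exact TrivSqZeroExt.snd_inr R s

/-- Multiplication by an element of the trivial extension. -/
noncomputable def mulMap (s : TrivSqZeroExt R Y) : selfModule R Y ⟶ selfModule R Y :=
  ModuleCat.ofHom (LinearMap.mulRight _ s)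

variable {R Y} in
lemma selfModule_hom_ext {W : ModuleCat.{u} (TrivSqZeroExt R Y)} {f g : selfModule R Y ⟶ W}
    (h : ∀ t : TrivSqZeroExt R Y, f.hom t = g.hom t) : f = g :=
  ModuleCat.hom_ext (LinearMap.ext h)

lemma eq_mulMap (f : selfModule R Y ⟶ selfModule R Y) :
    f = mulMap R Y (f.hom (1 : TrivSqZeroExt R Y)) := by
  refine selfModule_hom_ext fun t => ?_
  have := f.hom.map_smul t (1 : TrivSqZeroExt R Y)
  rwa [smul_eq_mul, mul_one] at this

variable {R Y}

lemma eq_zero_of_map_restriction {X : ModuleCat.{u} R} {W : ModuleCat.{u} (TrivSqZeroExt R Y)}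
    {a b : ℤ} (h : ∀ g : (singleFunctor _ a).obj X ⟶
      (singleFunctor _ b).obj ((restriction R Y).obj W), g = 0)
    (g : (singleFunctor _ a).obj X ⟶ (derivedRestriction R Y).obj ((singleFunctor _ b).obj W)) :
    g = 0 := by
  rw [← cancel_mono (((restriction R Y).mapDerivedCategorySingleFunctor b).hom.app W), zero_comp]
  exact h _

lemma eq_zero_of_ext_summands [HasExt.{w} (ModuleCat.{u} R)] {X : ModuleCat.{u} R} {j : ℕ}
    (h₁ : Subsingleton (Abelian.Ext X (ModuleCat.of R R) j))
    (h₂ : Subsingleton (Abelian.Ext X (ModuleCat.of R Y) j)) {a b : ℤ} (h : b + j = a)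
    (g : (singleFunctor _ a).obj X ⟶
      (derivedRestriction R Y).obj ((singleFunctor _ b).obj (selfModule R Y))) : g = 0 := by
  refine eq_zero_of_map_restriction (fun g => ?_) g
  rw [← Category.comp_id g, ← CategoryTheory.Functor.map_id, ← fst_inl_add_snd_inr,
    Functor.map_add, Functor.map_comp, Functor.map_comp, Preadditive.comp_add, ← Category.assoc,
    ← Category.assoc, eq_zero_of_subsingleton_ext X _ j a b h (g ≫ _),
    eq_zero_of_subsingleton_ext X _ j a b h (g ≫ _), zero_comp, zero_comp, add_zero]

variable (Y) in
/-- The elements of the trivial extension that annihilate `Ext¹(X, R ⋉ Y)`. -/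
noncomputable def annihilatorIdeal (X : ModuleCat.{u} R) : Ideal (TrivSqZeroExt R Y) where
  carrier := {s | ∀ x : (singleFunctor _ 1).obj X ⟶ (derivedRestriction R Y).obj (ringObj _),
    x ≫ (derivedRestriction R Y).map ((singleFunctor _ 0).map (mulMap R Y s)) = 0}
  zero_mem' x := by
    have : mulMap R Y 0 = 0 := selfModule_hom_ext fun _ => mul_zero _
    rw [this, Functor.map_zero, Functor.map_zero, comp_zero]
  add_mem' {s t} hs ht x := by
    have : mulMap R Y (s + t) = mulMap R Y s + mulMap R Y t :=
      selfModule_hom_ext fun _ => mul_add _ _ _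
    rw [this, Functor.map_add, Functor.map_add, Preadditive.comp_add, hs, ht, add_zero]
  smul_mem' c s hs x := by
    have : mulMap R Y (c • s) = mulMap R Y c ≫ mulMap R Y s :=
      selfModule_hom_ext fun _ => (mul_assoc _ _ _).symm
    rw [this, Functor.map_comp, Functor.map_comp, ← Category.assoc, hs]

/-- As an `R`-linear map, multiplication by `inr y` factors through the projection to `R`, and
`Ext¹(X, R) = 0`. -/
lemma inr_mem_annihilatorIdeal [HasExt.{w} (ModuleCat.{u} R)] {X : ModuleCat.{u} R}
    (h : Subsingleton (Abelian.Ext X (ModuleCat.of R R) 1)) (y : Y) :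
    TrivSqZeroExt.inr y ∈ annihilatorIdeal Y X := by
  intro x
  have hm : (restriction R Y).map (mulMap R Y (TrivSqZeroExt.inr y)) =
      fstMap R Y ≫ ModuleCat.ofHom (LinearMap.toSpanSingleton R Y y) ≫ inrMap R Y := by
    ext s
    change TrivSqZeroExt R Y at s
    change s * TrivSqZeroExt.inr y = TrivSqZeroExt.inr (s.fst • y)
    ext <;> simp
  let e := (restriction R Y).mapDerivedCategorySingleFunctor 0
  have he := e.hom.naturality (mulMap R Y (TrivSqZeroExt.inr y))
  rw [← cancel_mono (e.hom.app _), zero_comp, Category.assoc]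
  refine (congrArg (x ≫ ·) he).trans ?_
  change x ≫ e.hom.app _ ≫ (singleFunctor _ 0).map
    ((restriction R Y).map (mulMap R Y (TrivSqZeroExt.inr y))) = 0
  rw [hm, Functor.map_comp, ← Category.assoc, ← Category.assoc,
    eq_zero_of_subsingleton_ext X _ 1 1 0 (by simp) ((x ≫ e.hom.app _) ≫ _), zero_comp]

/-- Over `R` the module `Y` is a direct summand of `R ⋉ Y`, so `Ext¹(X, R ⋉ Y)` is nonzero. -/
lemma one_notMem_annihilatorIdeal [HasExt.{w} (ModuleCat.{u} R)] {X : ModuleCat.{u} R}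
    (h : Nontrivial (Abelian.Ext X (ModuleCat.of R Y) 1)) :
    1 ∉ annihilatorIdeal Y X := by
  intro h1
  refine not_subsingleton_iff_nontrivial.2 h (subsingleton_ext_of_eq_zero X _ 1 fun g => ?_)
  have hone : mulMap R Y 1 = 𝟙 _ := selfModule_hom_ext fun _ => mul_one _
  let e := (restriction R Y).mapDerivedCategorySingleFunctor 0
  have h2 := h1 (g ≫ (singleFunctor _ 0).map (inrMap R Y) ≫ e.inv.app _)
  rw [hone, CategoryTheory.Functor.map_id, CategoryTheory.Functor.map_id, Category.comp_id] at h2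
  have h3 := h2 =≫ (e.hom.app _ ≫ (singleFunctor _ 0).map (sndMap R Y))
  rw [zero_comp] at h3
  simp only [Category.assoc] at h3
  refine Eq.trans ?_ h3
  rw [Iso.inv_hom_id_app_assoc]
  refine Eq.trans ?_ (congrArg (g ≫ ·) (Functor.map_comp _ _ _))
  rw [inrMap_sndMap]
  simp

variable (Y) in
/-- The trivial extension modulo the annihilator of `Ext¹(X, R ⋉ Y)`. -/
noncomputable abbrev annihilatorQuotient (X : ModuleCat.{u} R) :
    ModuleCat.{u} (TrivSqZeroExt R Y) :=
  ModuleCat.of (TrivSqZeroExt R Y) (TrivSqZeroExt R Y ⧸ annihilatorIdeal Y X)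

variable (Y) in
noncomputable def annihilatorMk (X : ModuleCat.{u} R) : selfModule R Y ⟶ annihilatorQuotient Y X :=
  ModuleCat.ofHom (annihilatorIdeal Y X).mkQ

lemma mulMap_annihilatorMk_eq_zero_iff (X : ModuleCat.{u} R) (s : TrivSqZeroExt R Y) :
    mulMap R Y s ≫ annihilatorMk Y X = 0 ↔ s ∈ annihilatorIdeal Y X := by
  constructor
  · intro h
    have : (annihilatorIdeal Y X).mkQ (1 * s) = 0 :=
      LinearMap.congr_fun (congrArg ModuleCat.Hom.hom h) (1 : TrivSqZeroExt R Y)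
    rwa [one_mul, Submodule.mkQ_apply, Submodule.Quotient.mk_eq_zero] at this
  · intro h
    refine selfModule_hom_ext fun t => ?_
    change (annihilatorIdeal Y X).mkQ (t * s) = 0
    rw [Submodule.mkQ_apply, Submodule.Quotient.mk_eq_zero]
    exact Ideal.mul_mem_left _ _ h

lemma exists_eq_mulMap_annihilatorMk (X : ModuleCat.{u} R)
    (f : selfModule R Y ⟶ annihilatorQuotient Y X) : ∃ s, f = mulMap R Y s ≫ annihilatorMk Y X := by
  obtain ⟨s, hs⟩ := (annihilatorIdeal Y X).mkQ_surjective (f.hom (1 : TrivSqZeroExt R Y))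
  refine ⟨s, selfModule_hom_ext fun t => ?_⟩
  have h1 := f.hom.map_smul t (1 : TrivSqZeroExt R Y)
  rw [smul_eq_mul, mul_one, ← hs, ← map_smul] at h1
  exact h1

/-- The compact connective objects with no positive maps from `X` have no maps to the quotient of
the trivial extension by the annihilator of `Ext¹(X, R ⋉ Y)`. -/
theorem leftOrth_of_isCompact [HasExt.{w} (ModuleCat.{u} R)] [IsNoetherianRing (TrivSqZeroExt R Y)]
    {X : ModuleCat.{u} R}
    (h₁ : ∀ i : ℕ, 0 < i → Subsingleton (Abelian.Ext X (ModuleCat.of R R) i))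
    (h₂ : ∀ i : ℕ, 1 < i → Subsingleton (Abelian.Ext X (ModuleCat.of R Y) i))
    {Z : D (TrivSqZeroExt R Y)} (hc : IsCompact.{u} Z) (hZ : connective _ Z)
    (hXZ : noPositiveMaps (derivedRestriction R Y) X Z) : leftOrth (annihilatorQuotient Y X) Z := by
  intro i g
  have := hZ.1
  obtain rfl | hi := Nat.eq_zero_or_pos i
  swap
  · exact TStructure.t.zero g 0 i (by lia)
  let φ : ringObj (TrivSqZeroExt R Y) ⟶ (singleFunctor _ 0).obj (annihilatorQuotient Y X) :=
    (singleFunctor _ 0).map (annihilatorMk Y X)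
  -- With `X` placed in degree `1`, maps to the ring are classes in `Ext¹`, and maps from `X[1]` to
  -- the ring in degree `-n` are classes in `Extⁿ`.
  refine eq_zero_of_isCompact (derivedRestriction R Y) (X := (singleFunctor _ 1).obj X) φ
    (fun f => ?_) (fun s => ?_) (fun n hn g => ?_) hZ.2 hc (fun g => hXZ 0 g) g
  · obtain ⟨f, rfl⟩ := (singleFunctor (ModuleCat.{u} (TrivSqZeroExt R Y)) 0).map_surjective f
    obtain ⟨s, rfl⟩ := exists_eq_mulMap_annihilatorMk X f
    exact ⟨(singleFunctor _ 0).map (mulMap R Y s), Functor.map_comp _ _ _⟩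
  · obtain ⟨s, rfl⟩ := (singleFunctor (ModuleCat.{u} (TrivSqZeroExt R Y)) 0).map_surjective s
    rw [eq_mulMap R Y s, ← Functor.map_comp, Functor.map_eq_zero_iff,
      mulMap_annihilatorMk_eq_zero_iff]
    rfl
  · let e := ((singleFunctors (ModuleCat.{u} R)).shiftIso 1 0 1 (by simp)).app X
    rw [← cancel_epi e.inv, comp_zero]
    exact eq_zero_of_ext_summands (h₁ n (by lia)) (h₂ n (by lia)) (by lia) _

/-- The object `(R ⋉ Y)[1] ⊕ R` is not `t`-proxy small. -/
theorem not_isTProxySmallObj_trivExtObj [HasExt.{w} (ModuleCat.{u} R)]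
    [IsNoetherianRing (TrivSqZeroExt R Y)] {X : ModuleCat.{u} R}
    (h₁ : ∀ i : ℕ, 0 < i → Subsingleton (Abelian.Ext X (ModuleCat.of R R) i))
    (h₂ : Nontrivial (Abelian.Ext X (ModuleCat.of R Y) 1))
    (h₃ : ∀ i : ℕ, 1 < i → Subsingleton (Abelian.Ext X (ModuleCat.of R Y) i)) :
    ¬ IsTProxySmallObj.{u} (trivExtObj R Y) := by
  intro h
  let E := trivExtObj R Y
  have hE₁ : connective _ E := by
    have := (isSuspended_connective (S := TrivSqZeroExt R Y)).extensions
    have := (isSuspended_connective (S := TrivSqZeroExt R Y)).shift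
    exact prop_biprod_of_closed₂ ((connective _).le_shift (1 : ℤ) _
      ⟨inferInstance, hasFiniteHomology_singleFunctor _ _⟩)
      ⟨inferInstance, hasFiniteHomology_singleFunctor _ _⟩
  have hE₂ : noPositiveMaps (derivedRestriction R Y) X E := by
    have := (isSuspended_noPositiveMaps (derivedRestriction R Y) X).extensions
    refine prop_biprod_of_closed₂ ?_ fun i => ?_
    · let e := ((singleFunctors (ModuleCat.{u} (TrivSqZeroExt R Y))).shiftIso 1 (-1) 0
        (by simp)).app (selfModule R Y)
      refine (noPositiveMaps _ X).prop_of_iso e.symm fun i => ?_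
      -- The shift turns `Ext^{i+1}` into `Ext^{i+2}`, which skips the nonzero `Ext¹(X, Y)`.
      exact eq_zero_of_ext_summands (h₁ (i + 2) (by lia)) (h₃ (i + 2) (by lia)) (by push_cast; ring)
    · refine eq_zero_of_map_restriction fun g => ?_
      have := h₁ (i + 1) (by lia)
      let a : (restriction R Y).obj (baseModule R Y) ⟶ ModuleCat.of R R :=
        ModuleCat.ofHom (X := (restriction R Y).obj (baseModule R Y))
          { toFun := fun r => (r : R), map_add' := fun _ _ => rfl, map_smul' := fun _ _ => rfl }
      let b : ModuleCat.of R R ⟶ (restriction R Y).obj (baseModule R Y) :=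
        ModuleCat.ofHom (Y := (restriction R Y).obj (baseModule R Y))
          { toFun := fun r => (r : R), map_add' := fun _ _ => rfl, map_smul' := fun _ _ => rfl }
      have hab : a ≫ b = 𝟙 _ := rfl
      rw [← Category.comp_id g, ← CategoryTheory.Functor.map_id, ← hab, Functor.map_comp,
        ← Category.assoc, eq_zero_of_subsingleton_ext X _ (i + 1) (i + 1) 0 (by simp) (g ≫ _),
        zero_comp]
  have hE : cocompletePreaisle.{u} (ObjectProperty.singleton E) E :=
    fun Q _ hQ => hQ _ ((ObjectProperty.singleton_iff _ _).2 rfl)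
  rw [IsTProxySmallObj, IsTProxySmall] at h
  rw [h] at hE
  have hE' := hE _ (isCocompletePreaisle_leftOrth (annihilatorQuotient Y X)) fun Z hZ =>
    leftOrth_of_isCompact h₁ h₃ hZ.2
      (hZ.1 _ isSuspended_connective (ObjectProperty.singleton_le_iff.2 hE₁))
      (hZ.1 _ (isSuspended_noPositiveMaps _ X) (ObjectProperty.singleton_le_iff.2 hE₂))
  -- The map `1 ↦ 1` is linear over the trivial extension because `Y` lies in the annihilator. It
  -- must vanish, as `R` is a retract of `E`.
  let ψ : baseModule R Y ⟶ annihilatorQuotient Y X := ModuleCat.ofHom (X := baseModule R Y)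
    { toFun := fun r => Submodule.Quotient.mk (TrivSqZeroExt.inl (show R from r))
      map_add' := fun r s => congrArg (annihilatorIdeal Y X).mkQ (TrivSqZeroExt.inl_add Y r s)
      map_smul' := fun (s : TrivSqZeroExt R Y) (r : R) => by
        change (annihilatorIdeal Y X).mkQ (TrivSqZeroExt.inl (s.fst * r)) =
          (annihilatorIdeal Y X).mkQ (s * TrivSqZeroExt.inl r)
        rw [← sub_eq_zero, ← map_sub, Submodule.mkQ_apply, Submodule.Quotient.mk_eq_zero]
        convert inr_mem_annihilatorIdeal (h₁ 1 one_pos) (-(r • s.snd)) using 1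
        ext <;> simp }
  have hψ : ψ = 0 := by
    apply (singleFunctor (ModuleCat.{u} (TrivSqZeroExt R Y)) 0).map_injective
    have := hE' 0 ((retractBase R Y).r ≫ (singleFunctor _ 0).map ψ)
    rw [Functor.map_zero, ← Category.id_comp ((singleFunctor _ 0).map ψ),
      ← (retractBase R Y).retract, Category.assoc]
    exact (congrArg _ this).trans comp_zero
  have h1 : (Submodule.Quotient.mk (TrivSqZeroExt.inl (1 : R)) :
      TrivSqZeroExt R Y ⧸ annihilatorIdeal Y X) = 0 :=
    LinearMap.congr_fun (congrArg ModuleCat.Hom.hom hψ) (1 : R)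
  rw [Submodule.Quotient.mk_eq_zero] at h1
  exact one_notMem_annihilatorIdeal h₂ h1

end NotTProxySmall

/-! ### The ring `A` in coordinates -/

section Model

open MvPolynomial

/-- Coordinates with respect to the monomial basis
`1, x₁, …, x₅, x₁x₂, x₁x₃, x₁x₄, x₁x₅, x₂x₅, x₁x₂x₅`. -/
@[ext]
structure Model (k : Type u) (α : k) : Type u where
  c : k
  c₁ : k
  c₂ : k
  c₃ : k
  c₄ : k
  c₅ : k
  c₁₂ : k
  c₁₃ : k
  c₁₄ : k
  c₁₅ : k
  c₂₅ : k
  c₁₂₅ : k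

namespace Model

variable {k : Type u} [Field k] {α : k}

instance : Zero (Model k α) := ⟨⟨0, 0, 0, 0, 0, 0, 0, 0, 0, 0, 0, 0⟩⟩

instance : One (Model k α) := ⟨⟨1, 0, 0, 0, 0, 0, 0, 0, 0, 0, 0, 0⟩⟩

instance : Add (Model k α) := ⟨fun p q => ⟨p.c + q.c, p.c₁ + q.c₁, p.c₂ + q.c₂, p.c₃ + q.c₃,
  p.c₄ + q.c₄, p.c₅ + q.c₅, p.c₁₂ + q.c₁₂, p.c₁₃ + q.c₁₃, p.c₁₄ + q.c₁₄, p.c₁₅ + q.c₁₅,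
  p.c₂₅ + q.c₂₅, p.c₁₂₅ + q.c₁₂₅⟩⟩

instance : Neg (Model k α) := ⟨fun p => ⟨-p.c, -p.c₁, -p.c₂, -p.c₃, -p.c₄, -p.c₅, -p.c₁₂, -p.c₁₃,
  -p.c₁₄, -p.c₁₅, -p.c₂₅, -p.c₁₂₅⟩⟩

/-- The structure constants come from the rewriting rules `x₂x₃ = -αx₁x₃`, `x₂x₄ = -x₁x₄`, `x₃² =
x₂x₅ - αx₁x₅`, `x₄² = x₂x₅ - x₁x₅`; thus `x₃ · x₁x₃` and `x₄ · x₁x₄` equal `x₁x₂x₅`. -/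
instance : Mul (Model k α) := ⟨fun p q =>
  { c := p.c * q.c
    c₁ := p.c * q.c₁ + p.c₁ * q.c
    c₂ := p.c * q.c₂ + p.c₂ * q.c
    c₃ := p.c * q.c₃ + p.c₃ * q.c
    c₄ := p.c * q.c₄ + p.c₄ * q.c
    c₅ := p.c * q.c₅ + p.c₅ * q.c
    c₁₂ := p.c * q.c₁₂ + p.c₁₂ * q.c + p.c₁ * q.c₂ + p.c₂ * q.c₁
    c₁₃ := p.c * q.c₁₃ + p.c₁₃ * q.c + p.c₁ * q.c₃ + p.c₃ * q.c₁ - α * (p.c₂ * q.c₃ + p.c₃ * q.c₂)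
    c₁₄ := p.c * q.c₁₄ + p.c₁₄ * q.c + p.c₁ * q.c₄ + p.c₄ * q.c₁ - (p.c₂ * q.c₄ + p.c₄ * q.c₂)
    c₁₅ := p.c * q.c₁₅ + p.c₁₅ * q.c + p.c₁ * q.c₅ + p.c₅ * q.c₁ - α * p.c₃ * q.c₃ - p.c₄ * q.c₄
    c₂₅ := p.c * q.c₂₅ + p.c₂₅ * q.c + p.c₂ * q.c₅ + p.c₅ * q.c₂ + p.c₃ * q.c₃ + p.c₄ * q.c₄
    c₁₂₅ := p.c * q.c₁₂₅ + p.c₁₂₅ * q.c + p.c₁ * q.c₂₅ + p.c₂₅ * q.c₁ + p.c₂ * q.c₁₅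
      + p.c₁₅ * q.c₂ + p.c₃ * q.c₁₃ + p.c₁₃ * q.c₃ + p.c₄ * q.c₁₄ + p.c₁₄ * q.c₄ + p.c₅ * q.c₁₂
      + p.c₁₂ * q.c₅ }⟩

lemma zero_def : (0 : Model k α) = ⟨0, 0, 0, 0, 0, 0, 0, 0, 0, 0, 0, 0⟩ := rfl

lemma one_def : (1 : Model k α) = ⟨1, 0, 0, 0, 0, 0, 0, 0, 0, 0, 0, 0⟩ := rfl

lemma add_def (p q : Model k α) : p + q = ⟨p.c + q.c, p.c₁ + q.c₁, p.c₂ + q.c₂, p.c₃ + q.c₃,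
  p.c₄ + q.c₄, p.c₅ + q.c₅, p.c₁₂ + q.c₁₂, p.c₁₃ + q.c₁₃, p.c₁₄ + q.c₁₄, p.c₁₅ + q.c₁₅,
  p.c₂₅ + q.c₂₅, p.c₁₂₅ + q.c₁₂₅⟩ := rfl

lemma neg_def (p : Model k α) : -p = ⟨-p.c, -p.c₁, -p.c₂, -p.c₃, -p.c₄, -p.c₅, -p.c₁₂, -p.c₁₃,
  -p.c₁₄, -p.c₁₅, -p.c₂₅, -p.c₁₂₅⟩ := rfl

lemma mul_def (p q : Model k α) : p * q =
  { c := p.c * q.c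
    c₁ := p.c * q.c₁ + p.c₁ * q.c
    c₂ := p.c * q.c₂ + p.c₂ * q.c
    c₃ := p.c * q.c₃ + p.c₃ * q.c
    c₄ := p.c * q.c₄ + p.c₄ * q.c
    c₅ := p.c * q.c₅ + p.c₅ * q.c
    c₁₂ := p.c * q.c₁₂ + p.c₁₂ * q.c + p.c₁ * q.c₂ + p.c₂ * q.c₁
    c₁₃ := p.c * q.c₁₃ + p.c₁₃ * q.c + p.c₁ * q.c₃ + p.c₃ * q.c₁ - α * (p.c₂ * q.c₃ + p.c₃ * q.c₂)
    c₁₄ := p.c * q.c₁₄ + p.c₁₄ * q.c + p.c₁ * q.c₄ + p.c₄ * q.c₁ - (p.c₂ * q.c₄ + p.c₄ * q.c₂)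
    c₁₅ := p.c * q.c₁₅ + p.c₁₅ * q.c + p.c₁ * q.c₅ + p.c₅ * q.c₁ - α * p.c₃ * q.c₃ - p.c₄ * q.c₄
    c₂₅ := p.c * q.c₂₅ + p.c₂₅ * q.c + p.c₂ * q.c₅ + p.c₅ * q.c₂ + p.c₃ * q.c₃ + p.c₄ * q.c₄
    c₁₂₅ := p.c * q.c₁₂₅ + p.c₁₂₅ * q.c + p.c₁ * q.c₂₅ + p.c₂₅ * q.c₁ + p.c₂ * q.c₁₅
      + p.c₁₅ * q.c₂ + p.c₃ * q.c₁₃ + p.c₁₃ * q.c₃ + p.c₄ * q.c₁₄ + p.c₁₄ * q.c₄ + p.c₅ * q.c₁₂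
      + p.c₁₂ * q.c₅ } := rfl

instance : CommRing (Model k α) where
  add_assoc p q r := by simp only [add_def, add_assoc]
  zero_add p := by simp only [add_def, zero_def, zero_add]
  add_zero p := by simp only [add_def, zero_def, add_zero]
  add_comm p q := by simp only [add_def, add_comm]
  neg_add_cancel p := by simp only [add_def, neg_def, zero_def, neg_add_cancel]
  nsmul := nsmulRec
  zsmul := zsmulRec
  mul_comm p q := by ext <;> simp only [mul_def] <;> ring
  mul_assoc p q r := by ext <;> simp only [mul_def] <;> ring
  left_distrib p q r := by ext <;> simp only [mul_def, add_def] <;> ring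
  right_distrib p q r := by ext <;> simp only [mul_def, add_def] <;> ring
  zero_mul p := by ext <;> simp [mul_def, zero_def]
  mul_zero p := by ext <;> simp [mul_def, zero_def]
  one_mul p := by ext <;> simp [mul_def, one_def]
  mul_one p := by ext <;> simp [mul_def, one_def]

/-- The inclusion of the scalars. -/
def const : k →+* Model k α where
  toFun r := ⟨r, 0, 0, 0, 0, 0, 0, 0, 0, 0, 0, 0⟩
  map_zero' := rfl
  map_one' := rfl
  map_add' r s := by simp [add_def]
  map_mul' r s := by simp [mul_def]

instance : Algebra k (Model k α) := const.toAlgebra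

lemma algebraMap_def (r : k) :
    algebraMap k (Model k α) r = ⟨r, 0, 0, 0, 0, 0, 0, 0, 0, 0, 0, 0⟩ := rfl

/-- The residue field. -/
def residue : Model k α →+* k where
  toFun p := p.c
  map_zero' := rfl
  map_one' := rfl
  map_add' _ _ := rfl
  map_mul' _ _ := rfl

/-- An element without constant term has fourth power zero, and a unit plus a nilpotent is a unit.
-/
instance : IsLocalHom (residue : Model k α →+* k) where
  map_nonunit p hp := by
    have hn : IsNilpotent (p - algebraMap k _ p.c) := by
      refine ⟨4, ?_⟩
      have h (n : Model k α) (hn : n.c = 0) : (n * n) * (n * n) = 0 := by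
        ext <;> simp [mul_def, zero_def, hn]
      have : (p - algebraMap k _ p.c).c = 0 := by
        rw [sub_eq_add_neg]
        simp [add_def, neg_def, algebraMap_def]
      rw [← h _ this]
      ring
    have hu : IsUnit (algebraMap k (Model k α) p.c) := hp.map (algebraMap k (Model k α))
    have := hn.isUnit_add_left_of_commute hu (Commute.all _ _)
    simpa using this

instance : IsLocalRing (Model k α) :=
  have : Nontrivial (Model k α) := ⟨0, 1, fun h => zero_ne_one (congrArg Model.c h)⟩
  (residue : Model k α →+* k).domain_isLocalRing

/-- The images of the variables. -/
def var : Fin 5 → Model k α :=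
  ![⟨0, 1, 0, 0, 0, 0, 0, 0, 0, 0, 0, 0⟩, ⟨0, 0, 1, 0, 0, 0, 0, 0, 0, 0, 0, 0⟩,
    ⟨0, 0, 0, 1, 0, 0, 0, 0, 0, 0, 0, 0⟩, ⟨0, 0, 0, 0, 1, 0, 0, 0, 0, 0, 0, 0⟩,
    ⟨0, 0, 0, 0, 0, 1, 0, 0, 0, 0, 0, 0⟩]

lemma var_zero : (var 0 : Model k α) = ⟨0, 1, 0, 0, 0, 0, 0, 0, 0, 0, 0, 0⟩ := rfl

lemma var_one : (var 1 : Model k α) = ⟨0, 0, 1, 0, 0, 0, 0, 0, 0, 0, 0, 0⟩ := rfl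

lemma var_two : (var 2 : Model k α) = ⟨0, 0, 0, 1, 0, 0, 0, 0, 0, 0, 0, 0⟩ := rfl

lemma var_three : (var 3 : Model k α) = ⟨0, 0, 0, 0, 1, 0, 0, 0, 0, 0, 0, 0⟩ := rfl

lemma var_four : (var 4 : Model k α) = ⟨0, 0, 0, 0, 0, 1, 0, 0, 0, 0, 0, 0⟩ := rfl

lemma var_relations :
    algebraMap k (Model k α) α * var 0 * var 2 + var 1 * var 2 = 0 ∧
    (var 0 * var 3 + var 1 * var 3 : Model k α) = 0 ∧
    var 2 ^ 2 + algebraMap k (Model k α) α * var 0 * var 4 - var 1 * var 4 = 0 ∧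
    (var 3 ^ 2 + var 0 * var 4 - var 1 * var 4 : Model k α) = 0 ∧
    (var 0 ^ 2 : Model k α) = 0 ∧ (var 1 ^ 2 : Model k α) = 0 ∧
    (var 2 * var 3 : Model k α) = 0 ∧ (var 2 * var 4 : Model k α) = 0 ∧
    (var 3 * var 4 : Model k α) = 0 ∧ (var 4 ^ 2 : Model k α) = 0 := by
  simp only [var_zero, var_one, var_two, var_three, var_four, pow_two, sub_eq_add_neg, mul_def,
      add_def, neg_def, zero_def,
    algebraMap_def, mul_zero, add_zero, zero_add, mul_one, neg_zero, add_neg_cancel,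
    neg_add_cancel, and_self]

end Model

variable {k : Type u} [Field k] {α : k}

/-- The ring `A` in coordinates. -/
noncomputable def toModel : A k α →ₐ[k] Model k α :=
  Ideal.Quotient.liftₐ (ringIdeal k α) (aeval Model.var) fun a ha => by
    rw [← AlgHom.coe_toRingHom, ← RingHom.mem_ker]
    revert a
    rw [← SetLike.le_def, ringIdeal, Ideal.span_le]
    obtain ⟨h1, h2, h3, h4, h5, h6, h7, h8, h9, h10⟩ := Model.var_relations (k := k) (α := α)
    rintro a (rfl | rfl | rfl | rfl | rfl | rfl | rfl | rfl | rfl | rfl) <;>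
    simpa only [SetLike.mem_coe, RingHom.mem_ker, AlgHom.coe_toRingHom, map_add, map_sub, map_mul,
      aeval_X, aeval_C, map_pow]

lemma toModel_x (i : Fin 5) : toModel (x k α i) = Model.var i :=
  aeval_X _ i

/-- The element of `A` with given coordinates. -/
noncomputable def ofModel (p : Model k α) : A k α :=
  algebraMap k _ p.c + algebraMap k _ p.c₁ * x k α 0 + algebraMap k _ p.c₂ * x k α 1 +
  algebraMap k _ p.c₃ * x k α 2 + algebraMap k _ p.c₄ * x k α 3 + algebraMap k _ p.c₅ * x k α 4 +
  algebraMap k _ p.c₁₂ * (x k α 0 * x k α 1) + algebraMap k _ p.c₁₃ * (x k α 0 * x k α 2) +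
  algebraMap k _ p.c₁₄ * (x k α 0 * x k α 3) + algebraMap k _ p.c₁₅ * (x k α 0 * x k α 4) +
  algebraMap k _ p.c₂₅ * (x k α 1 * x k α 4) + algebraMap k _ p.c₁₂₅ * (x k α 0 * x k α 1 * x k α 4)

lemma toModel_ofModel (p : Model k α) : toModel (ofModel p) = p := by
  simp only [ofModel, map_add, map_mul, toModel_x, AlgHom.commutes]
  simp only [Model.var_zero, Model.var_one, Model.var_two, Model.var_three, Model.var_four,
    Model.mul_def, Model.add_def, Model.algebraMap_def, mul_zero, add_zero, zero_add,
    mul_one, sub_zero]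

lemma relation {f : MvPolynomial (Fin 5) k} (hf : f ∈ ringIdeal k α) :
    Ideal.Quotient.mk (ringIdeal k α) f = 0 :=
  Ideal.Quotient.eq_zero_iff_mem.2 hf

lemma scalar_eq : scalar k α = algebraMap k (A k α) α := rfl

lemma x_relations :
    algebraMap k (A k α) α * x k α 0 * x k α 2 + x k α 1 * x k α 2 = 0 ∧
    x k α 0 * x k α 3 + x k α 1 * x k α 3 = 0 ∧
    x k α 2 ^ 2 + algebraMap k (A k α) α * x k α 0 * x k α 4 - x k α 1 * x k α 4 = 0 ∧
    x k α 3 ^ 2 + x k α 0 * x k α 4 - x k α 1 * x k α 4 = 0 ∧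
    x k α 0 ^ 2 = 0 ∧ x k α 1 ^ 2 = 0 ∧ x k α 2 * x k α 3 = 0 ∧ x k α 2 * x k α 4 = 0 ∧
    x k α 3 * x k α 4 = 0 ∧ x k α 4 ^ 2 = 0 := by
  refine ⟨?_, ?_, ?_, ?_, ?_, ?_, ?_, ?_, ?_, ?_⟩ <;>
  · refine relation (Ideal.subset_span ?_)
    simp

lemma ofModel_add (p q : Model k α) : ofModel (p + q) = ofModel p + ofModel q := by
  simp only [ofModel, Model.add_def, map_add]
  ring

/-- The normal forms are stable under multiplication by the variables, so they exhaust `A`. -/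
lemma ofModel_mul_var (p : Model k α) (i : Fin 5) :
    ofModel (p * Model.var i) = ofModel p * x k α i := by
  obtain ⟨h1, h2, h3, h4, h5, h6, h7, h8, h9, h10⟩ := x_relations (k := k) (α := α)
  obtain ⟨c, c₁, c₂, c₃, c₄, c₅, c₁₂, c₁₃, c₁₄, c₁₅, c₂₅, c₁₂₅⟩ := p
  fin_cases i <;> simp only [Fin.isValue, Fin.zero_eta, Fin.mk_one, Fin.reduceFinMk, ofModel,
    Model.var_zero, Model.var_one, Model.var_two, Model.var_three, Model.var_four, Model.mul_def,
    mul_zero, zero_mul, add_zero, zero_add, mul_one, sub_zero, zero_sub, map_zero, map_neg, map_mul, map_sub]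
  all_goals generalize algebraMap k (A k α) α = α', algebraMap k (A k α) c = c,
    algebraMap k (A k α) c₁ = c₁, algebraMap k (A k α) c₂ = c₂, algebraMap k (A k α) c₃ = c₃, algebraMap k (A k α) c₄ = c₄,
    algebraMap k (A k α) c₅ = c₅, algebraMap k (A k α) c₁₂ = c₁₂, algebraMap k (A k α) c₁₃ = c₁₃,
    algebraMap k (A k α) c₁₄ = c₁₄, algebraMap k (A k α) c₁₅ = c₁₅, algebraMap k (A k α) c₂₅ = c₂₅,
    algebraMap k (A k α) c₁₂₅ = c₁₂₅ at *
  all_goals generalize x k α 0 = x₁, x k α 1 = x₂, x k α 2 = x₃, x k α 3 = x₄, x k α 4 = x₅ at *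
  all_goals grind

end Model

/-! ### Self-injectivity of `A` -/

section Gorenstein

open MvPolynomial

/-- A commutative algebra of finite dimension over a field with a nondegenerate linear form is
self-injective. -/
theorem baer_of_nondegenerate {k B : Type*} [Field k] [CommRing B] [Algebra k B]
    [FiniteDimensional k B] (l : B →ₗ[k] k) (hl : ∀ b, (∀ p, l (b * p) = 0) → b = 0) :
    Module.Baer B B := by
  intro I g
  let Φ : B →ₗ[k] Module.Dual k B := (LinearMap.mul k B).compr₂ l
  have hΦ : Function.Injective Φ := (injective_iff_map_eq_zero Φ).2 fun b hb =>
    hl b fun p => LinearMap.congr_fun hb p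
  have hΦ' : Function.Surjective Φ := (LinearMap.injective_iff_surjective_of_finrank_eq_finrank
    (Subspace.dual_finrank_eq (K := k) (V := B)).symm).1 hΦ
  -- Extend the functional `l ∘ g` from `I` to `B` over the field, and represent it as `l (b * -)`.
  -- Nondegeneracy then shows that `g` is multiplication by `b`.
  obtain ⟨L, hL⟩ := (l ∘ₗ g.restrictScalars k).exists_extend (p := I.restrictScalars k)
  obtain ⟨b, rfl⟩ := hΦ' L
  refine ⟨LinearMap.mulLeft B b, fun x hx => ?_⟩
  refine sub_eq_zero.1 (hl _ fun y => ?_)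
  have h1 : l (b * (x * y)) = l (g ⟨x * y, I.mul_mem_right y hx⟩) :=
    LinearMap.congr_fun hL ⟨x * y, I.mul_mem_right y hx⟩
  have h2 : g ⟨x * y, I.mul_mem_right y hx⟩ = y * g ⟨x, hx⟩ := by
    have : (⟨x * y, I.mul_mem_right y hx⟩ : I) = y • ⟨x, hx⟩ := Subtype.ext (mul_comm _ _)
    rw [this, map_smul, smul_eq_mul]
  rw [LinearMap.mulLeft_apply, sub_mul, map_sub, mul_assoc, h1, h2, mul_comm y, sub_self]

variable {k : Type u} [Field k] {α : k}

lemma ofModel_surjective : Function.Surjective (ofModel : Model k α → A k α) := by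
  intro a
  obtain ⟨f, rfl⟩ := Ideal.Quotient.mk_surjective a
  induction f using MvPolynomial.induction_on with
  | C r => exact ⟨algebraMap k _ r, by
      simp only [ofModel, Model.algebraMap_def, map_zero, zero_mul, add_zero]
      rfl⟩
  | add f g hf hg =>
    obtain ⟨p, hp⟩ := hf
    obtain ⟨q, hq⟩ := hg
    exact ⟨p + q, by rw [ofModel_add, hp, hq, map_add]⟩
  | mul_X f i hf =>
    obtain ⟨p, hp⟩ := hf
    exact ⟨p * Model.var i, by rw [ofModel_mul_var, hp, map_mul, x]⟩

lemma ofModel_toModel (a : A k α) : ofModel (toModel a) = a := by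
  obtain ⟨p, rfl⟩ := ofModel_surjective a
  rw [toModel_ofModel]

variable (k α) in
/-- The coordinates on the ring `A`. -/
noncomputable def modelEquiv : A k α ≃ₐ[k] Model k α :=
  { toModel with
    invFun := ofModel
    left_inv := ofModel_toModel
    right_inv := toModel_ofModel }

lemma modelEquiv_x (i : Fin 5) : modelEquiv k α (x k α i) = Model.var i := toModel_x i

namespace Model

lemma smul_def (r : k) (p : Model k α) : r • p = ⟨r * p.c, r * p.c₁, r * p.c₂, r * p.c₃, r * p.c₄,
    r * p.c₅, r * p.c₁₂, r * p.c₁₃, r * p.c₁₄, r * p.c₁₅, r * p.c₂₅, r * p.c₁₂₅⟩ := by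
  simp only [Algebra.smul_def, algebraMap_def, mul_def, zero_mul, mul_zero, add_zero, sub_zero]

lemma finite : Module.Finite k (Model k α) := by
  let f : (Fin 12 → k) →ₗ[k] Model k α :=
    { toFun v := ⟨v 0, v 1, v 2, v 3, v 4, v 5, v 6, v 7, v 8, v 9, v 10, v 11⟩
      map_add' _ _ := rfl
      map_smul' r v := by rw [smul_def]; rfl }
  exact Module.Finite.of_surjective f fun p =>
    ⟨![p.c, p.c₁, p.c₂, p.c₃, p.c₄, p.c₅, p.c₁₂, p.c₁₃, p.c₁₄, p.c₁₅, p.c₂₅, p.c₁₂₅], rfl⟩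

/-- The coordinate of the socle. -/
def socleForm : Model k α →ₗ[k] k where
  toFun p := p.c₁₂₅
  map_add' _ _ := rfl
  map_smul' r p := by rw [smul_def]; rfl

/-- The pairing permutes the monomial basis: each basis element, multiplied into `p`, reads off
exactly one coordinate. -/
lemma eq_zero_of_socleForm {p : Model k α} (h : ∀ q, socleForm (p * q) = 0) : p = 0 := by
  have h' (q : Model k α) : (p * q).c₁₂₅ = 0 := h q
  have h1 := h' ⟨1, 0, 0, 0, 0, 0, 0, 0, 0, 0, 0, 0⟩
  have h2 := h' ⟨0, 1, 0, 0, 0, 0, 0, 0, 0, 0, 0, 0⟩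
  have h3 := h' ⟨0, 0, 1, 0, 0, 0, 0, 0, 0, 0, 0, 0⟩
  have h4 := h' ⟨0, 0, 0, 1, 0, 0, 0, 0, 0, 0, 0, 0⟩
  have h5 := h' ⟨0, 0, 0, 0, 1, 0, 0, 0, 0, 0, 0, 0⟩
  have h6 := h' ⟨0, 0, 0, 0, 0, 1, 0, 0, 0, 0, 0, 0⟩
  have h7 := h' ⟨0, 0, 0, 0, 0, 0, 1, 0, 0, 0, 0, 0⟩
  have h8 := h' ⟨0, 0, 0, 0, 0, 0, 0, 1, 0, 0, 0, 0⟩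
  have h9 := h' ⟨0, 0, 0, 0, 0, 0, 0, 0, 1, 0, 0, 0⟩
  have h10 := h' ⟨0, 0, 0, 0, 0, 0, 0, 0, 0, 1, 0, 0⟩
  have h11 := h' ⟨0, 0, 0, 0, 0, 0, 0, 0, 0, 0, 1, 0⟩
  have h12 := h' ⟨0, 0, 0, 0, 0, 0, 0, 0, 0, 0, 0, 1⟩
  simp only [mul_def, mul_zero, mul_one, add_zero, zero_add] at *
  ext <;> assumption

end Model

instance : Module.Finite k (A k α) :=
  have : Module.Finite k (Model k α) := Model.finite
  Module.Finite.equiv (modelEquiv k α).symm.toLinearEquiv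

instance : IsArtinianRing (A k α) := IsArtinianRing.of_finite k _

instance : IsLocalRing (A k α) := (modelEquiv k α).symm.toRingEquiv.isLocalRing

instance : Injective (ModuleCat.of (A k α) (A k α)) := by
  have : Module.Baer (A k α) (A k α) := by
    refine baer_of_nondegenerate (k := k) (Model.socleForm ∘ₗ (modelEquiv k α).toLinearMap)
      fun b hb => ?_
    rw [← map_eq_zero_iff _ (modelEquiv k α).injective]
    refine Model.eq_zero_of_socleForm fun q => ?_
    obtain ⟨p, rfl⟩ := (modelEquiv k α).surjective q
    rw [← map_mul]
    exact hb p
  have := this.injective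
  exact (Module.injective_iff_injective_object _ _).1 this

variable (k α) in
theorem isGorensteinLocalRing : IsGorensteinLocalRing (A k α) where
  noetherian := inferInstance
  isLocal := inferInstance
  injdim := ⟨0, inferInstanceAs (HasInjectiveDimensionLT _ (0 + 1))⟩

end Gorenstein

/-! ### Dimension shifting for `Ext` -/

section DimensionShift

variable {S : Type u} [CommRing S] {F N : Type u} [AddCommGroup F]
  [Module S F] [AddCommGroup N] [Module S N] {K : Submodule S F} {g : F →ₗ[S] N}

lemma shortComplex_zero (hK : LinearMap.ker g = K) :
    ModuleCat.ofHom K.subtype ≫ ModuleCat.ofHom g = 0 := by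
  ext x
  exact (LinearMap.mem_ker (f := g)).1 (hK ▸ x.2)

lemma shortExact_of_surjective (hg : Function.Surjective g) (hK : LinearMap.ker g = K) :
    (ShortComplex.mk _ _ (shortComplex_zero hK)).ShortExact :=
  ModuleCat.shortComplex_shortExact _
    (fun x => by
      change g x = 0 ↔ x ∈ Set.range K.subtype
      rw [← LinearMap.mem_ker, hK, Submodule.coe_subtype, Subtype.range_coe]
      rfl) K.injective_subtype hg

variable [HasExt.{w} (ModuleCat.{u} S)]

lemma subsingleton_ext_succ [Projective (ModuleCat.of S F)] (hg : Function.Surjective g)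
    (hK : LinearMap.ker g = K) (Y : ModuleCat.{u} S) (n : ℕ)
    (h : Subsingleton (Abelian.Ext (ModuleCat.of S K) Y n)) :
    Subsingleton (Abelian.Ext (ModuleCat.of S N) Y (n + 1)) := by
  refine subsingleton_of_forall_eq 0 fun x => ?_
  obtain ⟨y, rfl⟩ := Abelian.Ext.contravariant_sequence_exact₃ (shortExact_of_surjective hg hK) Y x
    (Abelian.Ext.eq_zero_of_projective (P := ModuleCat.of S F) _) (add_comm 1 n)
  rw [Subsingleton.elim y 0, Abelian.Ext.comp_zero]

/-- With `F` projective, `Ext¹(N, Y)` is the cokernel of the restriction `Hom(F, Y) → Hom(K, Y)`. -/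
lemma subsingleton_ext_one [Projective (ModuleCat.of S F)] (hg : Function.Surjective g)
    (hK : LinearMap.ker g = K) {Y : Type u} [AddCommGroup Y] [Module S Y]
    (h : ∀ f : K →ₗ[S] Y, ∃ f' : F →ₗ[S] Y, f' ∘ₗ K.subtype = f) :
    Subsingleton (Abelian.Ext (ModuleCat.of S N) (ModuleCat.of S Y) 1) := by
  refine subsingleton_of_forall_eq 0 fun x => ?_
  obtain ⟨y, rfl⟩ := Abelian.Ext.contravariant_sequence_exact₃ (shortExact_of_surjective hg hK) _ x
    (Abelian.Ext.eq_zero_of_projective (P := ModuleCat.of S F) _) (add_comm 1 0)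
  obtain ⟨f, rfl⟩ := (Abelian.Ext.mk₀_bijective _ _).2 y
  obtain ⟨f', hf⟩ := h f.hom
  have : f = ModuleCat.ofHom K.subtype ≫ ModuleCat.ofHom f' := ModuleCat.hom_ext hf.symm
  rw [this, ← Abelian.Ext.mk₀_comp_mk₀]
  exact (shortExact_of_surjective hg hK).extClass_comp_assoc _

lemma nontrivial_ext_one (hg : Function.Surjective g)
    (hK : LinearMap.ker g = K) {Y : Type u} [AddCommGroup Y] [Module S Y] (f : K →ₗ[S] Y)
    (h : ∀ f' : F →ₗ[S] Y, f' ∘ₗ K.subtype ≠ f) :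
    Nontrivial (Abelian.Ext (ModuleCat.of S N) (ModuleCat.of S Y) 1) := by
  refine ⟨(shortExact_of_surjective hg hK).extClass.comp (Abelian.Ext.mk₀ (ModuleCat.ofHom f))
    (add_zero 1), 0, fun h0 => ?_⟩
  obtain ⟨y, hy⟩ := Abelian.Ext.contravariant_sequence_exact₁ _ _ _ _ h0
  obtain ⟨f', rfl⟩ := (Abelian.Ext.mk₀_bijective _ _).2 y
  rw [Abelian.Ext.mk₀_comp_mk₀] at hy
  exact h f'.hom (congrArg ModuleCat.Hom.hom ((Abelian.Ext.mk₀_bijective _ _).1 hy))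

end DimensionShift

/-! ### The twisted resolution of `M` and its maps to `T` -/

section Resolution

variable (k : Type u) [Field k] (α : k)

/-- The differentials `(x₁, αⁿ x₃; x₄, x₂)` of a free resolution. -/
noncomputable def differential (n : ℕ) : (Fin 2 → A k α) →ₗ[A k α] (Fin 2 → A k α) :=
  (!![x k α 0, algebraMap k _ (α ^ n) * x k α 2; x k α 3, x k α 1] :
    Matrix (Fin 2) (Fin 2) (A k α)).mulVecLin

variable {k α}

lemma differential_apply (n : ℕ) (v : Fin 2 → A k α) :
    differential k α n v = ![x k α 0 * v 0 + algebraMap k _ (α ^ n) * x k α 2 * v 1,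
      x k α 3 * v 0 + x k α 1 * v 1] := by
  rw [differential, Matrix.mulVecLin_apply]
  ext i
  fin_cases i <;> simp [Matrix.mulVec, dotProduct, Fin.sum_univ_two]

lemma matrixM_mulVecLin : (matrixM k α).mulVecLin = differential k α 1 := by
  rw [matrixM, differential, pow_one, scalar_eq]

lemma Model.exists_of_mem_ker (hα : α ≠ 0) (β : k) (hβ : β ≠ 0) (p q : Model k α)
    (h₁ : Model.var 0 * p + algebraMap k _ β * Model.var 2 * q = 0)
    (h₂ : Model.var 3 * p + Model.var 1 * q = 0) :
    ∃ r s : Model k α, p = Model.var 0 * r + algebraMap k _ (β * α) * Model.var 2 * s ∧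
      q = Model.var 3 * r + Model.var 1 * s := by
  obtain ⟨p0, p1, p2, p3, p4, p5, pa, pb, pc, pd, pe, pw⟩ := p
  obtain ⟨q0, q1, q2, q3, q4, q5, qa, qb, qc, qd, qe, qw⟩ := q
  simp only [var_zero, var_one, var_two, var_three, mul_def, algebraMap_def, add_def, zero_def,
    mk.injEq, mul_zero, zero_mul, add_zero, zero_add, mul_one, one_mul, sub_zero,
    zero_sub] at h₁ h₂ ⊢
  obtain ⟨-, rfl, -, -, -, -, rfl, h3, rfl, h5, h3', he⟩ := h₁
  obtain ⟨-, -, rfl, -, -, -, rfl, -, h4, -, h5', hd⟩ := h₂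
  obtain rfl : q3 = 0 := by simpa [hβ] using h3'
  -- Solved degree by degree: constant terms from linear coefficients, linear terms from quadratic
  -- ones. The socle coefficients `pw` and `qw` are reached as `x₁ · x₂x₅` and `x₂ · x₁x₅`.
  refine ⟨⟨p1, 0, pa, pb - β * α * qa, pc, pd - α * β * qb, 0, 0, 0, 0, pw, 0⟩,
    ⟨q2, qa, 0, -(qb / α), -pa - qc, qe - pc, 0, 0, 0, qw, 0, 0⟩, ?_⟩
  refine ⟨⟨rfl, rfl, rfl, ?_, rfl, ?_, rfl, ?_, rfl, ?_, ?_, ?_⟩, rfl, rfl, rfl, rfl, ?_, ?_, rfl,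
    ?_, ?_, ?_, ?_, ?_⟩ <;> grind

/-- The relation `αx₁x₃ + x₂x₃ = 0` makes consecutive differentials compose to zero only after
twisting `x₃` by one more factor `α`. Exactness is linear algebra in coordinates. -/
lemma ker_differential (hα : α ≠ 0) (n : ℕ) :
    LinearMap.ker (differential k α n) = LinearMap.range (differential k α (n + 1)) := by
  obtain ⟨h1, h2, h3, h4, h5, h6, h7, h8, h9, h10⟩ := x_relations (k := k) (α := α)
  apply le_antisymm
  · intro v hv
    rw [LinearMap.mem_ker, differential_apply] at hv
    have hv0 : _ = (0 : A k α) := congrFun hv 0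
    have hv1 : _ = (0 : A k α) := congrFun hv 1
    obtain ⟨r, s, hr, hs⟩ := Model.exists_of_mem_ker hα (α ^ n) (pow_ne_zero _ hα)
      (modelEquiv k α (v 0)) (modelEquiv k α (v 1))
      (by simpa [modelEquiv_x] using congrArg (modelEquiv k α) hv0)
      (by simpa [modelEquiv_x] using congrArg (modelEquiv k α) hv1)
    refine ⟨![(modelEquiv k α).symm r, (modelEquiv k α).symm s], ?_⟩
    rw [differential_apply]
    ext i
    apply (modelEquiv k α).injective
    fin_cases i
    · simpa [modelEquiv_x, pow_succ] using hr.symm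
    · simpa [modelEquiv_x] using hs.symm
  · rintro _ ⟨v, rfl⟩
    rw [LinearMap.mem_ker, differential_apply, differential_apply]
    ext i
    fin_cases i
    · simp only [pow_succ, map_mul]
      simp
      linear_combination v 0 * h5 + algebraMap k _ α ^ n * v 0 * h7 + algebraMap k _ α ^ n * v 1
          * h1
    · simp only [pow_succ, map_mul]
      simp
      linear_combination v 0 * h2 + algebraMap k _ α ^ n * algebraMap k _ α * v 1 * h7 + v 1 * h6

variable (k α) in
/-- The syzygies of the resolution. -/
noncomputable abbrev syzygy (n : ℕ) : Submodule (A k α) (Fin 2 → A k α) :=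
  LinearMap.range (differential k α n)

lemma ker_rangeRestrict_differential (hα : α ≠ 0) (n : ℕ) :
    LinearMap.ker (differential k α n).rangeRestrict = syzygy k α (n + 1) := by
  rw [LinearMap.ker_rangeRestrict, ker_differential hα]

/-- The images of the variables in the dual numbers. -/
def dualVar (α : k) : Fin 5 → k := ![1, α, 1, 1, 0]

variable (k α) in
/-- The map `A → k[ε]` with kernel the ideal that defines `T`. -/
noncomputable def toDual : A k α →ₐ[k] DualNumber k :=
  Ideal.Quotient.liftₐ (ringIdeal k α)
    (MvPolynomial.aeval fun i => dualVar α i • DualNumber.eps) fun a ha => by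
    rw [← AlgHom.coe_toRingHom, ← RingHom.mem_ker]
    revert a
    rw [← SetLike.le_def, ringIdeal, Ideal.span_le]
    rintro a (rfl | rfl | rfl | rfl | rfl | rfl | rfl | rfl | rfl | rfl) <;>
    simp [RingHom.mem_ker, pow_two, mul_assoc]

lemma toDual_x (i : Fin 5) : toDual k α (x k α i) = dualVar α i • DualNumber.eps :=
  MvPolynomial.aeval_X _ i

variable (k α) in
/-- The ideal that defines `T`. -/
noncomputable abbrev idealT : Ideal (A k α) := Ideal.span
    {x k α 0 - x k α 2, x k α 0 - x k α 3, x k α 1 - scalar k α * x k α 0, x k α 4}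

lemma toDual_eq_zero {a : A k α} (ha : a ∈ idealT k α) : toDual k α a = 0 := by
  revert a
  suffices idealT k α ≤ RingHom.ker (toDual k α).toRingHom from fun a ha => this ha
  rw [Ideal.span_le]
  rintro a (rfl | rfl | rfl | rfl) <;>
  simp [RingHom.mem_ker, toDual_x, dualVar, scalar_eq, Algebra.smul_def]

/-- Modulo the ideal every normal form reduces to `c + c'x₁`, and `toDual` reads off both
coefficients. -/
lemma mem_idealT_iff (a : A k α) : a ∈ idealT k α ↔ toDual k α a = 0 := by
  constructor
  · exact toDual_eq_zero
  · intro ha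
    obtain ⟨p, rfl⟩ := ofModel_surjective a
    have h0 : x k α 0 ^ 2 = 0 := (x_relations (k := k) (α := α)).2.2.2.2.1
    have key : Ideal.Quotient.mk (idealT k α) (ofModel p) = Ideal.Quotient.mk (idealT k α)
        (algebraMap k _ p.c + algebraMap k _ (p.c₁ + α * p.c₂ + p.c₃ + p.c₄) * x k α 0) := by
      have h2 : Ideal.Quotient.mk (idealT k α) (x k α 2) = Ideal.Quotient.mk _ (x k α 0) :=
        (Ideal.Quotient.eq.2 (Ideal.subset_span (by simp))).symm
      have h3 : Ideal.Quotient.mk (idealT k α) (x k α 3) = Ideal.Quotient.mk _ (x k α 0) :=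
        (Ideal.Quotient.eq.2 (Ideal.subset_span (by simp))).symm
      have h1 : Ideal.Quotient.mk (idealT k α) (x k α 1) =
          Ideal.Quotient.mk _ (scalar k α * x k α 0) :=
        Ideal.Quotient.eq.2 (Ideal.subset_span (by simp))
      have h4 : Ideal.Quotient.mk (idealT k α) (x k α 4) = 0 :=
        Ideal.Quotient.eq_zero_iff_mem.2 (Ideal.subset_span (by simp))
      have h00 := congrArg (Ideal.Quotient.mk (idealT k α)) h0
      rw [ofModel]
      simp only [map_add, map_mul, h1, h2, h3, h4, scalar_eq, map_zero, map_pow] at h00 ⊢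
      linear_combination (Ideal.Quotient.mk (idealT k α) (algebraMap k _ p.c₁₂) *
        Ideal.Quotient.mk (idealT k α) (algebraMap k _ α) +
        Ideal.Quotient.mk (idealT k α) (algebraMap k _ p.c₁₃) +
        Ideal.Quotient.mk (idealT k α) (algebraMap k _ p.c₁₄)) * h00
    rw [Ideal.Quotient.eq] at key
    have h := toDual_eq_zero key
    rw [map_sub, ha, zero_sub, neg_eq_zero, map_add, map_mul, toDual_x, AlgHom.commutes,
      AlgHom.commutes] at h
    have hc := congrArg TrivSqZeroExt.fst h
    have hs := congrArg TrivSqZeroExt.snd h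
    simp [dualVar, TrivSqZeroExt.algebraMap_eq_inl] at hc hs
    rw [hc, hs] at key
    simpa using key

lemma mk_eq_mk_iff (a b : A k α) : (Ideal.Quotient.mk (idealT k α) a) = Ideal.Quotient.mk _ b ↔
    toDual k α a = toDual k α b := by
  rw [Ideal.Quotient.eq, mem_idealT_iff, map_sub, sub_eq_zero]

/-- A map out of the free module `A²`. -/
noncomputable def fromFree (t₀ t₁ : T k α) : (Fin 2 → A k α) →ₗ[A k α] T k α :=
  (LinearMap.proj 0).smulRight t₀ + (LinearMap.proj 1).smulRight t₁

lemma fromFree_apply (t₀ t₁ : T k α) (v : Fin 2 → A k α) :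
    fromFree t₀ t₁ v = v 0 • t₀ + v 1 • t₁ := rfl

lemma exists_eq_fromFree (f : (Fin 2 → A k α) →ₗ[A k α] T k α) : ∃ a b : A k α,
    f = fromFree (Ideal.Quotient.mk _ a) (Ideal.Quotient.mk _ b) := by
  obtain ⟨a, ha⟩ := Ideal.Quotient.mk_surjective (f ![1, 0])
  obtain ⟨b, hb⟩ := Ideal.Quotient.mk_surjective (f ![0, 1])
  refine ⟨a, b, LinearMap.ext fun v => ?_⟩
  rw [fromFree_apply, ha, hb, ← map_smul, ← map_smul, ← map_add]
  congr 1
  ext i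
  fin_cases i <;> simp

lemma fromFree_mk_apply (a b : A k α) (v : Fin 2 → A k α) :
    fromFree (Ideal.Quotient.mk _ a) (Ideal.Quotient.mk _ b) v =
      Ideal.Quotient.mk _ (v 0 * a + v 1 * b) := rfl

lemma fromFree_eq_zero_iff {a b : A k α} {v : Fin 2 → A k α} :
    fromFree (Ideal.Quotient.mk _ a) (Ideal.Quotient.mk _ b) v = 0 ↔
      toDual k α (v 0 * a + v 1 * b) = 0 := by
  rw [fromFree_mk_apply, Ideal.Quotient.eq_zero_iff_mem, mem_idealT_iff]

/-- Maps from a syzygy to `T` extend to `A²` except for the first one. -/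
lemma exists_extension (hα : α ≠ 0) {n : ℕ} (hn : α ^ n ≠ 1) (hn' : α ^ n ≠ α)
    (f : syzygy k α n →ₗ[A k α] T k α) : ∃ f' : (Fin 2 → A k α) →ₗ[A k α] T k α,
    f' ∘ₗ (syzygy k α n).subtype = f := by
  obtain ⟨a, b, hf⟩ := exists_eq_fromFree (f ∘ₗ (differential k α n).rangeRestrict)
  have hker (v : Fin 2 → A k α) (hv : differential k α n v = 0) :
      toDual k α (v 0 * a + v 1 * b) = 0 := by
    rw [← fromFree_eq_zero_iff, ← hf, LinearMap.comp_apply]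
    have : (differential k α n).rangeRestrict v = 0 := Subtype.ext hv
    rw [this, map_zero]
  have hd (v) : differential k α n (differential k α (n + 1) v) = 0 := by
    rw [← LinearMap.mem_ker, ker_differential hα]
    exact ⟨v, rfl⟩
  have h1 := hker _ (hd ![1, 0])
  have h2 := hker _ (hd ![0, 1])
  rw [differential_apply] at h1 h2
  have h1' := congrArg TrivSqZeroExt.snd h1
  have h2' := congrArg TrivSqZeroExt.snd h2
  simp [toDual_x, dualVar, mul_assoc, TrivSqZeroExt.algebraMap_eq_inl] at h1' h2'
  -- Vanishing on the image of the next differential is a linear system in the constant terms of `a`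
  -- and `b` with determinant `α - αⁿ⁺¹`, nonzero by `hn`.
  have ha : (toDual k α a).fst = 0 := by
    have : (α * (α ^ n - 1)) * (toDual k α a).fst = 0 := by linear_combination h2' - α * h1'
    exact (mul_eq_zero.1 this).resolve_left (mul_ne_zero hα (sub_ne_zero.2 hn))
  have hb : (toDual k α b).fst = 0 := by rwa [ha, zero_add] at h1'
  have hn'' := sub_ne_zero.2 hn'
  -- Now `a` and `b` are multiples of `ε`. The constants `h`, `h'` of an extension must satisfy `h +
  -- h' = a'` and `αⁿh + αh' = b'` for their `ε`-parts, a system with determinant `α - αⁿ`.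
  obtain ⟨h, hh⟩ : ∃ h : k, h * (α ^ n - α) = (toDual k α b).snd - α * (toDual k α a).snd :=
    ⟨_, div_mul_cancel₀ _ hn''⟩
  refine ⟨fromFree (Ideal.Quotient.mk _ (algebraMap k _ h))
    (Ideal.Quotient.mk _ (algebraMap k _ ((toDual k α a).snd - h))), ?_⟩
  suffices fromFree (Ideal.Quotient.mk _ (algebraMap k _ h))
    (Ideal.Quotient.mk _ (algebraMap k _ ((toDual k α a).snd - h))) ∘ₗ differential k α n =
      fromFree (Ideal.Quotient.mk _ a) (Ideal.Quotient.mk _ b) by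
    rw [← hf] at this
    refine LinearMap.ext ?_
    rintro ⟨_, v, rfl⟩
    exact LinearMap.congr_fun this v
  refine LinearMap.ext fun v => ?_
  rw [LinearMap.comp_apply, fromFree_mk_apply, fromFree_mk_apply, mk_eq_mk_iff, differential_apply]
  ext
  · simp [toDual_x, dualVar, ha, hb]
  · simp [toDual_x, dualVar, ha, hb, TrivSqZeroExt.algebraMap_eq_inl]
    linear_combination (toDual k α (v 1)).fst * hh

/-- The map from the first syzygy to `T` that does not extend. -/
lemma exists_not_extension (hα : α ≠ 0) : ∃ f : syzygy k α 1 →ₗ[A k α] T k α,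
    ∀ f' : (Fin 2 → A k α) →ₗ[A k α] T k α, f' ∘ₗ (syzygy k α 1).subtype ≠ f := by
  -- For `n = 1` the maps that extend have `ε`-parts proportional to `(1, α)`; the choice `(1, 0)`
  -- is not of this form.
  let φ : (Fin 2 → A k α) →ₗ[A k α] T k α :=
    fromFree (Ideal.Quotient.mk _ (x k α 0)) (Ideal.Quotient.mk _ 0)
  have hφ : LinearMap.ker (differential k α 1) ≤ LinearMap.ker φ := by
    rw [ker_differential hα]
    rintro _ ⟨v, rfl⟩
    rw [LinearMap.mem_ker, fromFree_eq_zero_iff, differential_apply]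
    ext <;> simp [toDual_x, dualVar]
  refine ⟨(LinearMap.ker (differential k α 1)).liftQ φ hφ ∘ₗ
    (differential k α 1).quotKerEquivRange.symm.toLinearMap, fun f' hf' => ?_⟩
  have h (v) : f' (differential k α 1 v) = φ v := by
    have hv := LinearMap.mem_range_self (differential k α 1) v
    exact (LinearMap.congr_fun hf' ⟨differential k α 1 v, hv⟩).trans
      (congrArg _ (LinearMap.quotKerEquivRange_symm_apply_image _ v hv))
  obtain ⟨a, b, rfl⟩ := exists_eq_fromFree f'
  have h1 := h ![1, 0]
  have h2 := h ![0, 1]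
  rw [fromFree_mk_apply, fromFree_mk_apply, mk_eq_mk_iff, differential_apply] at h1 h2
  have h1' := congrArg TrivSqZeroExt.snd h1
  have h2' := congrArg TrivSqZeroExt.snd h2
  simp [toDual_x, dualVar, TrivSqZeroExt.algebraMap_eq_inl] at h1' h2'
  rw [← mul_add, h1', mul_one] at h2'
  exact hα h2'

end Resolution

/-! ### The `Ext` groups of `M` -/

section Ext

variable {k : Type u} [Field k] {α : k}

instance : Projective (ModuleCat.of (A k α) (Fin 2 → A k α)) :=
  (IsProjective.iff_projective _).1 inferInstance

/-- Dimension shifting reduces to `Ext¹` of later syzygies. There the maps to extend start from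
syzygy `n + 1 ≥ 2`, so `αⁿ⁺¹` is neither `1` nor `α`. -/
lemma subsingleton_ext_syzygy (hα : α ≠ 0) (h : ∀ n : ℕ, 0 < n → α ^ n ≠ 1) (i n : ℕ)
    (hn : 0 < n) : Subsingleton (Abelian.Ext (ModuleCat.of (A k α) (syzygy k α n))
      (ModuleCat.of (A k α) (T k α)) (i + 1)) := by
  induction i generalizing n with
  | zero =>
    refine subsingleton_ext_one (differential k α n).surjective_rangeRestrict
      (ker_rangeRestrict_differential hα n) (exists_extension hα (h _ n.succ_pos) fun h' => ?_)
    rw [pow_succ] at h'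
    exact h n hn (mul_right_cancel₀ hα (h'.trans (one_mul α).symm))
  | succ i ih =>
    exact subsingleton_ext_succ (differential k α n).surjective_rangeRestrict
      (ker_rangeRestrict_differential hα n) _ _ (ih (n + 1) n.succ_pos)

lemma ker_mkQ_eq_syzygy : LinearMap.ker (LinearMap.range (matrixM k α).mulVecLin).mkQ =
    syzygy k α 1 := by
  rw [Submodule.ker_mkQ, matrixM_mulVecLin]

theorem subsingleton_ext_M_T (hα : α ≠ 0) (h : ∀ n : ℕ, 0 < n → α ^ n ≠ 1) (i : ℕ) (hi : 1 < i) :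
    Subsingleton (Abelian.Ext (ModuleCat.of (A k α) (M k α)) (ModuleCat.of (A k α) (T k α)) i) := by
  obtain ⟨j, rfl⟩ := Nat.exists_eq_add_of_le' (show 2 ≤ i from hi)
  exact subsingleton_ext_succ (Submodule.mkQ_surjective _) ker_mkQ_eq_syzygy _ (j + 1)
    (subsingleton_ext_syzygy hα h j 1 one_pos)

theorem nontrivial_ext_M_T (hα : α ≠ 0) :
    Nontrivial (Abelian.Ext (ModuleCat.of (A k α) (M k α)) (ModuleCat.of (A k α) (T k α)) 1) := by
  obtain ⟨f, hf⟩ := exists_not_extension hα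
  exact nontrivial_ext_one (Submodule.mkQ_surjective _) ker_mkQ_eq_syzygy f hf

theorem subsingleton_ext_A (X : ModuleCat.{u} (A k α)) (i : ℕ) (hi : 0 < i) :
    Subsingleton (Abelian.Ext X (ModuleCat.of (A k α) (A k α)) i) :=
  HasInjectiveDimensionLT.subsingleton _ 1 i hi X

end Ext

/-! ### Trivial extensions of local Artinian rings -/

section Local

variable (R : Type u) [CommRing R] (Y : Type u) [AddCommGroup Y] [Module R Y] [Module Rᵐᵒᵖ Y]
  [IsCentralScalar R Y]

lemma isArtinianRing_trivSqZeroExt [IsArtinianRing R] [Module.Finite R Y] :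
    IsArtinianRing (TrivSqZeroExt R Y) :=
  have := finite_trivSqZeroExt R Y
  isArtinian_of_tower R (isArtinian_of_fg_of_artinian' (R := R) (M := TrivSqZeroExt R Y))

lemma isLocalRing_trivSqZeroExt [IsLocalRing R] : IsLocalRing (TrivSqZeroExt R Y) := by
  have : IsLocalHom (TrivSqZeroExt.fstHom R R Y).toRingHom :=
    ⟨fun _ h => TrivSqZeroExt.isUnit_iff_isUnit_fst.2 h⟩
  exact (TrivSqZeroExt.fstHom R R Y).toRingHom.domain_isLocalRing

end Local

end ProxySmall

theorem mainTheorem10 :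
    -- the general construction
    (∀ (R : Type u) [CommRing R] [IsNoetherianRing R]
        (X : Type u) [AddCommGroup X] [Module R X]
        (Y : Type u) [AddCommGroup Y] [Module R Y] [Module Rᵐᵒᵖ Y] [IsCentralScalar R Y]
        [Module.Finite R Y],
        (∀ i : ℕ, 0 < i → Subsingleton (Abelian.Ext (ModuleCat.of R X) (ModuleCat.of R R) i)) →
        Nontrivial (Abelian.Ext (ModuleCat.of R X) (ModuleCat.of R Y) 1) →
        (∀ i : ℕ, 1 < i → Subsingleton (Abelian.Ext (ModuleCat.of R X) (ModuleCat.of R Y) i)) →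
        IsNoetherianRing (TrivSqZeroExt R Y) ∧
        ProxySmall.IsBoundedCoherent (ProxySmall.trivExtObj R Y) ∧
        ProxySmall.IsProxySmallObj.{u} (ProxySmall.trivExtObj R Y) ∧
        ¬ ProxySmall.IsTProxySmallObj.{u} (ProxySmall.trivExtObj R Y)) ∧
    -- the Artinian Gorenstein ring and its two modules
    (∀ (k : Type u) [Field k] (α : k), α ≠ 0 → (∀ n : ℕ, 0 < n → α ^ n ≠ 1) →
        IsArtinianRing (ProxySmall.A k α) ∧
        ProxySmall.IsGorensteinLocalRing (ProxySmall.A k α) ∧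
        (∀ i : ℕ, 0 < i → Subsingleton (Abelian.Ext
          (ModuleCat.of (ProxySmall.A k α) (ProxySmall.M k α))
          (ModuleCat.of (ProxySmall.A k α) (ProxySmall.A k α)) i)) ∧
        Nontrivial (Abelian.Ext
          (ModuleCat.of (ProxySmall.A k α) (ProxySmall.M k α))
          (ModuleCat.of (ProxySmall.A k α) (ProxySmall.T k α)) 1) ∧
        (∀ i : ℕ, 1 < i → Subsingleton (Abelian.Ext
          (ModuleCat.of (ProxySmall.A k α) (ProxySmall.M k α))
          (ModuleCat.of (ProxySmall.A k α) (ProxySmall.T k α)) i)) ∧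
        ProxySmall.IsBoundedCoherent
          (ProxySmall.trivExtObj (ProxySmall.A k α) (ProxySmall.T k α)) ∧
        ProxySmall.IsProxySmallObj.{u}
          (ProxySmall.trivExtObj (ProxySmall.A k α) (ProxySmall.T k α)) ∧
        ¬ ProxySmall.IsTProxySmallObj.{u}
          (ProxySmall.trivExtObj (ProxySmall.A k α) (ProxySmall.T k α))) ∧
    -- `t`-proxy smallness implies proxy smallness
    (∀ (C : Type u₁) [Category.{v₁} C] [HasZeroObject C] [HasShift C ℤ] [Preadditive C]
        [∀ n : ℤ, (shiftFunctor C n).Additive] [Pretriangulated C] [IsTriangulated C]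
        [HasCoproducts.{w} C] (P : ObjectProperty C) [ObjectProperty.EssentiallySmall.{w} P],
        ProxySmall.IsTProxySmall.{w} P → ProxySmall.IsProxySmall.{w} P) ∧
    -- and the converse fails
    (∃ (S : Type u) (_ : CommRing S) (E : ProxySmall.D S),
        IsLocalRing S ∧ IsArtinianRing S ∧ ProxySmall.IsBoundedCoherent E ∧
        ProxySmall.IsProxySmallObj.{u} E ∧ ¬ ProxySmall.IsTProxySmallObj.{u} E) := by
  have part1 (R : Type u) [CommRing R] [IsNoetherianRing R]
      (X : Type u) [AddCommGroup X] [Module R X]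
      (Y : Type u) [AddCommGroup Y] [Module R Y] [Module Rᵐᵒᵖ Y] [IsCentralScalar R Y]
      [Module.Finite R Y]
      (h₁ : ∀ i : ℕ, 0 < i → Subsingleton (Abelian.Ext (ModuleCat.of R X) (ModuleCat.of R R) i))
      (h₂ : Nontrivial (Abelian.Ext (ModuleCat.of R X) (ModuleCat.of R Y) 1))
      (h₃ : ∀ i : ℕ, 1 < i → Subsingleton (Abelian.Ext (ModuleCat.of R X) (ModuleCat.of R Y) i)) :
      IsNoetherianRing (TrivSqZeroExt R Y) ∧
      ProxySmall.IsBoundedCoherent (ProxySmall.trivExtObj R Y) ∧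
      ProxySmall.IsProxySmallObj.{u} (ProxySmall.trivExtObj R Y) ∧
      ¬ ProxySmall.IsTProxySmallObj.{u} (ProxySmall.trivExtObj R Y) := by
    have := ProxySmall.isNoetherianRing_trivSqZeroExt R Y
    exact ⟨this, ProxySmall.isBoundedCoherent_trivExtObj R Y,
      ProxySmall.isProxySmallObj_trivExtObj R Y,
      ProxySmall.not_isTProxySmallObj_trivExtObj h₁ h₂ h₃⟩
  have part2 (k : Type u) [Field k] (α : k) (hα : α ≠ 0) (h : ∀ n : ℕ, 0 < n → α ^ n ≠ 1) :=
    part1 (ProxySmall.A k α) (ProxySmall.M k α) (ProxySmall.T k α)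
      (ProxySmall.subsingleton_ext_A _) (ProxySmall.nontrivial_ext_M_T hα)
      (ProxySmall.subsingleton_ext_M_T hα h)
  refine ⟨fun R _ _ X _ _ Y _ _ _ _ _ => part1 R X Y, fun k _ α hα h => ⟨inferInstance,
    ProxySmall.isGorensteinLocalRing k α, ProxySmall.subsingleton_ext_A _,
    ProxySmall.nontrivial_ext_M_T hα, ProxySmall.subsingleton_ext_M_T hα h, (part2 k α hα h).2⟩,
    fun C _ _ _ _ _ _ _ _ P _ hP => hP.isProxySmall, ?_⟩
  -- The example is taken over `ℚ`, lifted to universe `u`, where `2` has infinite multiplicative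
  -- order.
  have h2 (n : ℕ) (hn : 0 < n) : (2 : ULift.{u} ℚ) ^ n ≠ 1 := fun h => by
    have : (2 : ℚ) ^ n = 1 := congrArg ULift.down h
    exact absurd this (one_lt_pow₀ one_lt_two hn.ne').ne'
  have h0 : (2 : ULift.{u} ℚ) ≠ 0 := fun h => two_ne_zero (α := ℚ) (congrArg ULift.down h)
  exact ⟨_, _, _, ProxySmall.isLocalRing_trivSqZeroExt _ _,
    ProxySmall.isArtinianRing_trivSqZeroExt _ _, (part2 (ULift.{u} ℚ) 2 h0 h2).2⟩
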